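/- Setting. Let $X\in\mathcal X$ have law $Q$ (a probability measure), let $\nu$ be a $\sigma$-finite measure on $\mathcal Y$, and let $\mathcal P$ be a family of conditional probability densities $p(y|x)$ of $Y$ given $X$ with respect to $\nu$. Let $p_0\in\mathcal P$, and let $(X_1,Y_1),\dots,(X_n,Y_n)$, $n\ge 1$, be i.i.d. with $X_i\sim Q$ and $Y_i|X_i\sim p_0(\cdot|X_i)$. Put $$\widehat L_n(p)=-\frac1n\sum_{i=1}^n\log p(Y_i|X_i)\quad(\text{with }-\log 0=+\infty),$$ suppose that (almost surely) a maximum likelihood estimator $\widehat p_n\in\arg\min_{p\in\mathcal P}\widehat L_n(p)$ exists and is chosen, and let $$\Omega_n(\alpha)=\{p\in\mathcal P:\widehat L_n(p)-\widehat L_n(\widehat p_n)\le\alpha\}.$$ For nonnegative measurable functions $p_1,p_2$ on $\mathcal X\times\mathcal Y$ let $$H^2(p_1,p_2)=\mathbb E_X\Big[\frac12\int\big(\sqrt{p_1(y|X)}-\sqrt{p_2(y|X)}\big)^2\,d\nu(y)\Big].$$ An $H$-bracket-cover of $\mathcal P$ at scale $\varepsilon>0$ is a set $\mathcal B$ of nonnegative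 measurable functions such that every $p\in\mathcal P$ satisfies $b_1\le p\le b_2$ pointwise for some $b_1,b_2\in\mathcal B$ with $H(b_1,b_2)\le\varepsilon$; $\mathcal N_{[]}(\varepsilon,\mathcal P,H)\in\mathbb N\cup\{\infty\}$ is the smallest cardinality of such a $\mathcal B$. Define $\kappa(0)=1$ and $\kappa(u)=\dfrac{2(e^{|u|/2}-1-|u|/2)}{(1-e^{-u/2})^2}$ for $u\ne0$, and $$c(\tau)=2\Big\{\frac{1-e^{-\tau}}4-\frac{\kappa(\tau)}{32(1-e^{-\tau})}\Big\},\qquad c_1=\frac{63}{257\times2^{14}}.$$ Theorem. (a) There are $a\in(0.5517,0.5518)$ and $b\in(3.1926,3.1927)$ such that, for $\tau>0$, $\kappa(\tau)<8(1-e^{-\tau})^2$ if and only if $a<\tau<b$. For every such $\tau$, $c(\tau)>0$. Moreover, $c$ attains its maximum over $(0,\infty)$ at a point of $(a,b)$ which is $1.7024$ to four decimals, and the maximum is $0.1802$ to four decimals. (b) There is a universal constant $c>0$ such that the following holds in every setting as above. Let $\tau>0$ satisfy $\kappa(\tau)<8(1-e^{-\tau})^2$. Let $\sigma_n,\alpha_n>0$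 satisfy $\alpha_n=\sigma_n^2/(8\kappa(\tau))$, $\sigma_n^2\ge n^{-1}$, $\sigma_n\le 2^{9}$ (that is, the lower limit of the integral below is at most half of the upper one; this is automatic if $\alpha_n\le 1$), and $$\int_{\sigma_n^2/2^{10}}^{\sigma_n}\sqrt{\log\mathcal N_{[]}\Big(\frac{u}{2\sqrt2\,e^{\tau/2}},\mathcal P,H\Big)}\,du\le\frac1{2^{27}}\sqrt n\,\sigma_n^2 .$$ Then for every $\alpha\ge\alpha_n/4$, with probability at least $1-c\,e^{-2c_1n\alpha}$, $$\text{(i) } p_0\in\Omega_n(\alpha)\qquad\text{and}\qquad\text{(ii) }\sup_{p\in\Omega_n(\alpha)}H^2(p,p_0)\le\frac{\alpha}{c(\tau)}$$ (that is, the event that (i) or (ii) fails has outer probability at most $c\,e^{-2c_1n\alpha}$). -/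

import Mathlib

open MeasureTheory ProbabilityTheory
open scoped ENNReal

noncomputable section

namespace CondMLE

/-- The function `κ`. -/
def kappa (u : ℝ) : ℝ :=
  if u = 0 then 1
  else 2 * (Real.exp (|u| / 2) - 1 - |u| / 2) / (1 - Real.exp (-u / 2)) ^ 2

/-- The constant `c(τ)`. -/
def cTau (τ : ℝ) : ℝ :=
  2 * ((1 - Real.exp (-τ)) / 4 - kappa τ / (32 * (1 - Real.exp (-τ))))

/-- The constant `c₁`. -/
def cOne : ℝ := 63 / (257 * 2 ^ 14)

variable {X Y : Type*} [MeasurableSpace X] [MeasurableSpace Y]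

/-- `p x y = p(y|x)` is a conditional probability density of `Y` given `X` with respect to `ν`. -/
structure IsCondDensity (ν : Measure Y) (p : X → Y → ℝ) : Prop where
  measurable : Measurable (Function.uncurry p)
  nonneg : ∀ x y, 0 ≤ p x y
  lintegral_eq_one : ∀ x, ∫⁻ y, ENNReal.ofReal (p x y) ∂ν = 1

/-- The law of `(X, Y)` when `X` has law `Q` and `Y` given `X = x` has density `p x` with
respect to `ν`. -/
def jointLaw (Q : Measure X) (ν : Measure Y) (p : X → Y → ℝ) : Measure (X × Y) :=
  (Q.prod ν).withDensity fun z => ENNReal.ofReal (p z.1 z.2)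

/-- The squared Hellinger distance `h²(p₁, p₂, x)` at `x`. -/
def hellingerSqAt (ν : Measure Y) (p₁ p₂ : X → Y → ℝ) (x : X) : ℝ≥0∞ :=
  2⁻¹ * ∫⁻ y, ENNReal.ofReal ((√(p₁ x y) - √(p₂ x y)) ^ 2) ∂ν

/-- The generalized squared Hellinger distance `H²(p₁, p₂)`, the expectation of
`h²(p₁, p₂, X)` for `X` of law `Q`. -/
def hellingerSq (Q : Measure X) (ν : Measure Y) (p₁ p₂ : X → Y → ℝ) : ℝ≥0∞ :=
  ∫⁻ x, hellingerSqAt ν p₁ p₂ x ∂Q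

/-- The generalized Hellinger distance `H(p₁, p₂)`. -/
def hellinger (Q : Measure X) (ν : Measure Y) (p₁ p₂ : X → Y → ℝ) : ℝ≥0∞ :=
  hellingerSq Q ν p₁ p₂ ^ (1 / 2 : ℝ)

/-- `B` is an `H`-bracket-cover of `P` at scale `ε`. -/
structure IsBracketCover (Q : Measure X) (ν : Measure Y) (ε : ℝ) (P B : Set (X → Y → ℝ)) :
    Prop where
  measurable : ∀ b ∈ B, Measurable (Function.uncurry b)
  nonneg : ∀ b ∈ B, ∀ x y, 0 ≤ b x y
  cover : ∀ p ∈ P, ∃ b₁ ∈ B, ∃ b₂ ∈ B, hellinger Q ν b₁ b₂ ≤ ENNReal.ofReal ε ∧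
    ∀ x y, b₁ x y ≤ p x y ∧ p x y ≤ b₂ x y

/-- The `H`-bracketing number of `P` at scale `ε` (it is `⊤` if there is no finite cover). -/
def bracketingNumber (Q : Measure X) (ν : Measure Y) (ε : ℝ) (P : Set (X → Y → ℝ)) : ℕ∞ :=
  ⨅ (B : Set (X → Y → ℝ)) (_ : IsBracketCover Q ν ε P B), B.encard

/-- The bracketing entropy, the logarithm of the bracketing number. The bracketing number of
a nonempty family is at least `1`, so that no negative value is cut off here. -/
def bracketingEntropy (Q : Measure X) (ν : Measure Y) (ε : ℝ) (P : Set (X → Y → ℝ)) : ℝ≥0∞ :=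
  (ENNReal.log (bracketingNumber Q ν ε P : ℝ≥0∞)).toENNReal

/-- The average negative log-likelihood of `p` on the data `D`, with `-log 0 = +∞`. -/
def negLogLik {n : ℕ} (D : Fin n → X × Y) (p : X → Y → ℝ) : EReal :=
  ((1 / (n : ℝ) : ℝ) : EReal) *
    ∑ i, -ENNReal.log (ENNReal.ofReal (p (D i).1 (D i).2))

/-- `q` is a maximum likelihood estimate in the family `P` for the data `D`. -/
def IsMLE {n : ℕ} (P : Set (X → Y → ℝ)) (D : Fin n → X × Y) (q : X → Y → ℝ) : Prop :=
  q ∈ P ∧ ∀ p ∈ P, negLogLik D q ≤ negLogLik D p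

/-- The likelihood-ratio uncertainty set with critical value `α`, for data `D` and maximum
likelihood estimate `pHat`. -/
def uncertaintySet {n : ℕ} (P : Set (X → Y → ℝ)) (D : Fin n → X × Y) (pHat : X → Y → ℝ)
    (α : ℝ) : Set (X → Y → ℝ) :=
  {p | p ∈ P ∧ negLogLik D p - negLogLik D pHat ≤ (α : EReal)}

end CondMLE

end
open CondMLE

/-! For (a), substitute w = e^{τ/2}. Admissibility becomes `phi w > 0` and c becomes `cW w`. The
derivatives of `phi` and of `mNum` (which carries the sign of the derivative of `cW`) are a positive
factor times a polynomial. Counting the sign changes of these polynomials gives the shape of `phi`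
and `cW`, and Taylor enclosures of exp locate the zeros.

For (b), let λ = 1 - e^{-τ}, h² = H²(p, p₀), and let U_p (`logMix` of the density ratio) be the
logarithm of e^{-τ} + λ p/p₀. Three facts make U_p the right object. It is bounded below by -τ, so
its exponential moments are controlled by κ(τ) E(1 - e^{U_p/2})² (`exp_mul_le_of_neg_le`). Its mean
is at most -λ²h²/2 (`integral_logMix_le`). By concavity λ log(p/p₀) ≤ U_p (`mul_log_le_logMix`).
Only upper deviations of sums of U_p therefore matter.

They are bounded uniformly in p by a one-sided chaining argument (`measure_chain_le`,
`measure_exists_dev_le`). Upper brackets are replaced by their running minima, so the links of the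
chain are nonnegative variables with small second moment. Only their lower tail is needed, and that
tail is sub-Gaussian without any boundedness, so no truncation occurs. The coarsest level is handled
by Chernoff's bound, and the finest one costs a bias.

Outside an event of probability at most c e^{-2c₁nα}, every p that is positive on the data satisfies
λ Σ log(p/p₀) < n(-λ²h²/2 + αK + κh²/64), where K is the constant of `dev_const_le`. Since K ≤ λ and
κ < 8λ², the right side is at most nλα. Applied to the maximum likelihood estimator this is (i). For
p in the uncertainty set the left side is at least -nλα. If α < c(τ)h², then c(τ) ≤ 1/4 and K ≤
3κ/16 make the fluctuation at most κh²/16, and λc(τ) = λ²/2 - κ/16 yields a contradiction. This is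
(ii). -/

namespace CondMLE

/-! ### Sign analysis of `phi`, `mNum` and `cW` in the variable w = e^{τ/2}. -/

/-- `phi w > 0` says that `κ(2 log w) < 8 (1 - w⁻²)²`. -/
noncomputable def phi (w : ℝ) : ℝ :=
  Real.log w - (w - 1) + 4 * (w - 1) ^ 4 * (w + 1) ^ 2 / w ^ 6

noncomputable def phiNum (w : ℝ) : ℝ := 8 * (w - 1) ^ 2 * (w + 1) * (w + 3) - w ^ 6

theorem hasDerivAt_phi {w : ℝ} (hw : 0 < w) :
    HasDerivAt phi ((w - 1) / w ^ 7 * phiNum w) w := by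
  have h0 := hw.ne'
  have h1 := (Real.hasDerivAt_log h0).sub ((hasDerivAt_id w).sub_const 1)
  have h2 : HasDerivAt (fun w : ℝ => 4 * (w - 1) ^ 4 * (w + 1) ^ 2)
      (4 * (4 * (w - 1) ^ 3) * (w + 1) ^ 2 + 4 * (w - 1) ^ 4 * (2 * (w + 1))) w := by
    have ha := (((hasDerivAt_id w).sub_const 1).pow 4).const_mul 4
    have hb := ((hasDerivAt_id w).add_const 1).pow 2
    refine (ha.mul hb).congr_deriv ?_
    simp
  have h3 := h2.div (hasDerivAt_pow 6 w) (pow_ne_zero 6 h0)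
  refine (h1.add h3).congr_deriv ?_
  unfold phiNum
  field_simp
  push_cast
  ring

/-- The sign of `mNum w` is that of the derivative of `c` at `2 log w`. -/
noncomputable def mNum (w : ℝ) : ℝ :=
  (w - 1 - Real.log w) - (w - 1) ^ 2 * (w + 1) / (2 * (w + 2))
    + 4 * (w - 1) ^ 4 * (w + 1) ^ 2 / ((w + 2) * w ^ 6)

noncomputable def mPoly (w : ℝ) : ℝ :=
  w ^ 6 * (-2 * w ^ 3 - 5 * w ^ 2 + 5 * w + 8)
    + 8 * (w - 1) ^ 2 * (w + 1) * (-w ^ 3 + 2 * w ^ 2 + 11 * w + 12)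

theorem hasDerivAt_mNum {w : ℝ} (hw : 0 < w) :
    HasDerivAt mNum ((w - 1) / (2 * w ^ 7 * (w + 2) ^ 2) * mPoly w) w := by
  have h0 := hw.ne'
  have h02 : w + 2 ≠ 0 := by positivity
  have h1 := ((hasDerivAt_id w).sub_const 1).sub (Real.hasDerivAt_log h0)
  have ha := ((hasDerivAt_id w).sub_const 1)
  have hb := ((hasDerivAt_id w).add_const 1)
  have hc := ((hasDerivAt_id w).add_const 2)
  have h2 := ((ha.pow 2).mul hb).div (hc.const_mul 2) (by simpa using h02)
  have h3 := (((ha.pow 4).const_mul 4).mul (hb.pow 2)).div (hc.mul (hasDerivAt_pow 6 w))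
    (mul_ne_zero h02 (pow_ne_zero 6 h0))
  refine ((h1.sub h2).add h3).congr_deriv ?_
  unfold mPoly
  simp
  field_simp
  ring

/-- `c(2 log w)` as a function of `w`. -/
noncomputable def cW (w : ℝ) : ℝ :=
  (1 - 1 / w ^ 2 - w ^ 4 * (w - 1 - Real.log w) / (4 * (w - 1) ^ 3 * (w + 1))) / 2

theorem hasDerivAt_cW {w : ℝ} (hw : 1 < w) :
    HasDerivAt cW (w ^ 3 * (w + 2) / (4 * (w - 1) ^ 4 * (w + 1) ^ 2) * mNum w) w := by
  have h0 : w ≠ 0 := by positivity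
  have h1 : w - 1 ≠ 0 := by linarith
  have h2 : w + 1 ≠ 0 := by linarith
  have h3 : w + 2 ≠ 0 := by linarith
  have ha := ((hasDerivAt_id w).sub_const 1)
  have hb := ((hasDerivAt_id w).add_const 1)
  have e1 := (hasDerivAt_const w (1:ℝ)).div (hasDerivAt_pow 2 w) (pow_ne_zero 2 h0)
  have e2 := ((hasDerivAt_pow 4 w).mul (ha.sub (Real.hasDerivAt_log h0))).div
    (((ha.pow 3).const_mul 4).mul hb) (mul_ne_zero (mul_ne_zero four_ne_zero (pow_ne_zero 3 h1)) h2)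
  refine ((((hasDerivAt_const w (1:ℝ)).sub e1).sub e2).div_const 2).congr_deriv ?_
  unfold mNum
  simp
  field_simp
  ring

/-- Compares `phiNum (1 + s) / s²` at two points without denominators. The last factor is positive
when both points lie in (0, 1] and negative when both lie in [1, ∞), so the quotient rises for w ≤ 2
and falls for w ≥ 2. This leaves at most one sign change of `phiNum` on each side. -/
theorem phiNum_cross (s t : ℝ) :
    phiNum (1 + t) * s ^ 2 = phiNum (1 + s) * t ^ 2 + (t - s) *
      (s ^ 2 * t ^ 2 * (28 - 7 * (s + t) - 6 * (s ^ 2 + s * t + t ^ 2) - (s + t) * (s ^ 2 + t ^ 2))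
        + (s + t) + 6 * (s * t)) := by
  unfold phiNum; ring

theorem phiNum_pos_of_nonneg {x y : ℝ} (hx : 1 < x) (hxy : x < y) (hy : y ≤ 2)
    (h : 0 ≤ phiNum x) : 0 < phiNum y := by
  obtain ⟨s, rfl⟩ : ∃ s, x = 1 + s := ⟨x - 1, by ring⟩
  obtain ⟨t, rfl⟩ : ∃ t, y = 1 + t := ⟨y - 1, by ring⟩
  have hs : 0 < s := by linarith
  have ht : 0 < t := by linarith
  have hst : s < t := by linarith
  have ht1 : t ≤ 1 := by linarith
  have hs1 : s < 1 := by linarith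
  have h1 : s * t < 1 := by nlinarith
  have h0 : 0 < s * t := by positivity
  have h2 : 2 * (s * t) ≤ s + t := by nlinarith
  have h3 : -8 ≤ 28 - 7 * (s + t) - 6 * (s ^ 2 + s * t + t ^ 2) - (s + t) * (s ^ 2 + t ^ 2) := by
    have : s ^ 2 ≤ 1 := by nlinarith
    have : t ^ 2 ≤ 1 := by nlinarith
    have : (s + t) * (s ^ 2 + t ^ 2) ≤ 2 * 2 := by gcongr <;> linarith
    linarith
  have hK : 0 < s ^ 2 * t ^ 2 * (28 - 7 * (s + t) - 6 * (s ^ 2 + s * t + t ^ 2)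
      - (s + t) * (s ^ 2 + t ^ 2)) + (s + t) + 6 * (s * t) := by
    have := mul_le_mul_of_nonneg_left h3 (by positivity : 0 ≤ s ^ 2 * t ^ 2)
    nlinarith
  have hc := phiNum_cross s t
  have : 0 < phiNum (1 + t) * s ^ 2 := by
    rw [hc]
    have := mul_pos (sub_pos.2 hst) hK
    positivity
  exact pos_of_mul_pos_left this (by positivity)

theorem phiNum_neg_of_nonpos {x y : ℝ} (hx : 2 ≤ x) (hxy : x < y)
    (h : phiNum x ≤ 0) : phiNum y < 0 := by
  obtain ⟨s, rfl⟩ : ∃ s, x = 1 + s := ⟨x - 1, by ring⟩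
  obtain ⟨t, rfl⟩ : ∃ t, y = 1 + t := ⟨y - 1, by ring⟩
  have hs : 1 ≤ s := by linarith
  have hst : s < t := by linarith
  have ht : 1 < t := by linarith
  have h1 : 1 < s * t := by nlinarith
  have h2 : s + t ≤ 2 * (s * t) := by nlinarith
  have h3 : 28 - 7 * (s + t) - 6 * (s ^ 2 + s * t + t ^ 2) - (s + t) * (s ^ 2 + t ^ 2) ≤ -8 := by
    have : 1 ≤ s ^ 2 := by nlinarith
    have : 1 ≤ t ^ 2 := by nlinarith
    have : 2 * 2 ≤ (s + t) * (s ^ 2 + t ^ 2) := by gcongr <;> linarith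
    linarith
  have hK : s ^ 2 * t ^ 2 * (28 - 7 * (s + t) - 6 * (s ^ 2 + s * t + t ^ 2)
      - (s + t) * (s ^ 2 + t ^ 2)) + (s + t) + 6 * (s * t) < 0 := by
    have := mul_le_mul_of_nonneg_left h3 (by positivity : 0 ≤ s ^ 2 * t ^ 2)
    nlinarith
  have hc := phiNum_cross s t
  have h4 : phiNum (1 + t) * s ^ 2 < 0 := by
    rw [hc]
    have := mul_neg_of_pos_of_neg (sub_pos.2 hst) hK
    have : phiNum (1 + s) * t ^ 2 ≤ 0 := mul_nonpos_of_nonpos_of_nonneg h (by positivity)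
    linarith
  by_contra h5
  have := mul_nonneg (not_lt.1 h5) (by positivity : 0 ≤ s ^ 2)
  linarith

/-- In powers of r = w - 1 the coefficients change sign once. Division by r³ leaves a nonincreasing
part minus a strictly increasing one. -/
theorem mPoly_neg_of_nonpos {x y : ℝ} (hx : 1 < x) (hxy : x < y) (h : mPoly x ≤ 0) :
    mPoly y < 0 := by
  obtain ⟨s, rfl⟩ : ∃ s, x = 1 + s := ⟨x - 1, by ring⟩
  obtain ⟨t, rfl⟩ : ∃ t, y = 1 + t := ⟨y - 1, by ring⟩
  have hs : 0 < s := by linarith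
  have hst : s < t := by linarith
  have ht : 0 < t := by linarith
  have key : ∀ r : ℝ, 0 < r → mPoly (1 + r) = r ^ 3 * ((6 / r ^ 3 + 25 / r ^ 2 + 397 / r + 271)
      - (227 * r + 403 * r ^ 2 + 273 * r ^ 3 + 107 * r ^ 4 + 23 * r ^ 5 + 2 * r ^ 6)) := by
    intro r hr
    unfold mPoly
    field_simp
    ring
  rw [key s hs] at h
  rw [key t ht]
  have h1 : 6 / t ^ 3 + 25 / t ^ 2 + 397 / t + 271 ≤ 6 / s ^ 3 + 25 / s ^ 2 + 397 / s + 271 := by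
    gcongr
  have h2 : 227 * s + 403 * s ^ 2 + 273 * s ^ 3 + 107 * s ^ 4 + 23 * s ^ 5 + 2 * s ^ 6 <
      227 * t + 403 * t ^ 2 + 273 * t ^ 3 + 107 * t ^ 4 + 23 * t ^ 5 + 2 * t ^ 6 := by
    gcongr
  have h3 : 0 < s ^ 3 := by positivity
  have h4 := nonpos_of_mul_nonpos_right h h3
  exact mul_neg_of_pos_of_neg (by positivity) (by linarith)

theorem continuousOn_phi : ContinuousOn phi (Set.Ioi 0) := fun _ hx =>
  (hasDerivAt_phi hx).continuousAt.continuousWithinAt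

theorem continuousOn_mNum : ContinuousOn mNum (Set.Ioi 0) := fun _ hx =>
  (hasDerivAt_mNum hx).continuousAt.continuousWithinAt

theorem continuousOn_cW : ContinuousOn cW (Set.Ioi 1) := fun _ hx =>
  (hasDerivAt_cW hx).continuousAt.continuousWithinAt

/-- The sign pattern of `phi` on `(1, ∞)` is negative, positive, negative. -/
theorem phi_pos_iff {a b : ℝ} (ha : 1 < a) (hb : 2 ≤ b)
    (hpa : phi a = 0) (hpb : phi b = 0) (hab : ∃ m, a < m ∧ m ≤ 2 ∧ 0 < phi m) {w : ℝ} (hw : 1 < w) :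
    0 < phi w ↔ a < w ∧ w < b := by
  -- The critical points w₁ < 2 < w₂ of `phi`: starting from `phi 1 = 0` it falls to w₁, rises to w₂
  -- and then falls again.
  obtain ⟨w₁, ⟨h1l, h1u⟩, hw1⟩ : (0 : ℝ) ∈ phiNum '' Set.Icc 1.2 1.3 := by
    refine intermediate_value_Icc (by norm_num) ?_ ⟨?_, ?_⟩
    · unfold phiNum; fun_prop
    · norm_num [phiNum]
    · norm_num [phiNum]
  obtain ⟨w₂, ⟨h2l, h2u⟩, hw2⟩ : (0 : ℝ) ∈ phiNum '' Set.Icc 3 4 := by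
    refine intermediate_value_Icc' (by norm_num) ?_ ⟨?_, ?_⟩
    · unfold phiNum; fun_prop
    · norm_num [phiNum]
    · norm_num [phiNum]
  have hcoef : ∀ x : ℝ, 1 < x → 0 < (x - 1) / x ^ 7 := fun x hx => by
    have : 0 < x - 1 := by linarith
    positivity
  have hanti1 : StrictAntiOn phi (Set.Icc 1 w₁) := by
    refine strictAntiOn_of_deriv_neg (convex_Icc _ _)
      (continuousOn_phi.mono fun x hx => Set.mem_Ioi.2 (by linarith [hx.1])) fun x hx => ?_
    rw [interior_Icc] at hx
    rw [(hasDerivAt_phi (by linarith [hx.1])).deriv]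
    refine mul_neg_of_pos_of_neg (hcoef x hx.1) ?_
    by_contra h
    exact (phiNum_pos_of_nonneg hx.1 hx.2 (by linarith) (not_lt.1 h)).ne' hw1
  have hmono : StrictMonoOn phi (Set.Icc w₁ w₂) := by
    refine strictMonoOn_of_deriv_pos (convex_Icc _ _)
      (continuousOn_phi.mono fun x hx => Set.mem_Ioi.2 (by linarith [hx.1])) fun x hx => ?_
    rw [interior_Icc] at hx
    rw [(hasDerivAt_phi (by linarith [hx.1])).deriv]
    refine mul_pos (hcoef x (by linarith [hx.1])) ?_
    rcases le_total x 2 with h2 | h2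
    · exact phiNum_pos_of_nonneg (by linarith) hx.1 h2 hw1.ge
    · by_contra h
      exact (phiNum_neg_of_nonpos h2 hx.2 (not_lt.1 h)).ne hw2
  have hanti2 : StrictAntiOn phi (Set.Ici w₂) := by
    refine strictAntiOn_of_deriv_neg (convex_Ici _)
      (continuousOn_phi.mono fun x hx => Set.mem_Ioi.2 (by linarith [Set.mem_Ici.1 hx]))
      fun x hx => ?_
    rw [interior_Ici, Set.mem_Ioi] at hx
    rw [(hasDerivAt_phi (by linarith)).deriv]
    exact mul_neg_of_pos_of_neg (hcoef x (by linarith))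
      (phiNum_neg_of_nonpos (by linarith) hx hw2.le)
  have hphi1 : phi 1 = 0 := by simp [phi]
  have hneg1 : ∀ x, 1 < x → x ≤ w₁ → phi x < 0 := fun x hx hx1 => by
    rw [← hphi1]; exact hanti1 ⟨le_rfl, by linarith⟩ ⟨hx.le, hx1⟩ hx
  have haw1 : w₁ < a := by
    by_contra h
    exact (hneg1 a ha (not_lt.1 h)).ne hpa
  obtain ⟨m, ham, hm2, hm⟩ := hab
  -- Otherwise `phi` would have the two zeros a < b on the interval [w₁, w₂], where it is strictly
  -- increasing.
  have hbw2 : w₂ < b := by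
    by_contra h
    have := hmono ⟨by linarith, by linarith⟩ ⟨by linarith, not_lt.1 h⟩ (show a < b by linarith)
    linarith
  rcases le_total w w₁ with h | h
  · exact ⟨fun hp => absurd hp (hneg1 w hw h).le.not_gt, fun hp => by linarith⟩
  rcases le_total w w₂ with h' | h'
  · rw [← hpa, hmono.lt_iff_lt ⟨by linarith, by linarith⟩ ⟨h, h'⟩]
    exact ⟨fun hp => ⟨hp, by linarith⟩, And.left⟩
  · rw [← hpb, hanti2.lt_iff_gt (Set.mem_Ici.2 hbw2.le) (Set.mem_Ici.2 h')]
    exact ⟨fun hp => ⟨by linarith, hp⟩, And.right⟩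

/-- `mNum` is positive before and negative after its zero. -/
theorem mNum_sign {z : ℝ} (hz : 1 < z) (hmz : mNum z = 0) :
    (∀ w, 1 < w → w < z → 0 < mNum w) ∧ ∀ w, z < w → mNum w < 0 := by
  obtain ⟨w₁, ⟨h1l, h1u⟩, hw1⟩ : (0 : ℝ) ∈ mPoly '' Set.Icc 1.2 2 := by
    refine intermediate_value_Icc' (by norm_num) ?_ ⟨?_, ?_⟩
    · unfold mPoly; fun_prop
    · norm_num [mPoly]
    · norm_num [mPoly]
  have hcoef : ∀ x : ℝ, 1 < x → 0 < (x - 1) / (2 * x ^ 7 * (x + 2) ^ 2) := fun x hx => by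
    have : 0 < x - 1 := by linarith
    positivity
  have hmono : StrictMonoOn mNum (Set.Icc 1 w₁) := by
    refine strictMonoOn_of_deriv_pos (convex_Icc _ _)
      (continuousOn_mNum.mono fun x hx => Set.mem_Ioi.2 (by linarith [hx.1])) fun x hx => ?_
    rw [interior_Icc] at hx
    rw [(hasDerivAt_mNum (by linarith [hx.1])).deriv]
    refine mul_pos (hcoef x hx.1) ?_
    by_contra h
    exact (mPoly_neg_of_nonpos hx.1 hx.2 (not_lt.1 h)).ne hw1
  have hanti : StrictAntiOn mNum (Set.Ici w₁) := by
    refine strictAntiOn_of_deriv_neg (convex_Ici _)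
      (continuousOn_mNum.mono fun x hx => Set.mem_Ioi.2 (by linarith [Set.mem_Ici.1 hx]))
      fun x hx => ?_
    rw [interior_Ici, Set.mem_Ioi] at hx
    rw [(hasDerivAt_mNum (by linarith)).deriv]
    exact mul_neg_of_pos_of_neg (hcoef x (by linarith))
      (mPoly_neg_of_nonpos (by linarith) hx hw1.le)
  have hm1 : mNum 1 = 0 := by simp [mNum]
  have hpos1 : ∀ x, 1 < x → x ≤ w₁ → 0 < mNum x := fun x hx hx1 => by
    rw [← hm1]; exact hmono ⟨le_rfl, by linarith⟩ ⟨hx.le, hx1⟩ hx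
  have hzw : w₁ < z := by
    by_contra h
    exact (hpos1 z hz (not_lt.1 h)).ne' hmz
  refine ⟨fun w hw hwz => ?_, fun w hw => ?_⟩
  · rcases le_total w w₁ with h | h
    · exact hpos1 w hw h
    · rw [← hmz]; exact hanti h hzw.le hwz
  · rw [← hmz]; exact hanti hzw.le (Set.mem_Ici.2 (by linarith)) hw

theorem cW_le_of_mNum_eq_zero {z : ℝ} (hz : 1 < z) (hmz : mNum z = 0) {w : ℝ} (hw : 1 < w) :
    cW w ≤ cW z := by
  obtain ⟨h1, h2⟩ := mNum_sign hz hmz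
  have hcoef : ∀ x : ℝ, 1 < x → 0 < x ^ 3 * (x + 2) / (4 * (x - 1) ^ 4 * (x + 1) ^ 2) :=
    fun x hx => by
      have : 0 < x - 1 := by linarith
      positivity
  rcases lt_trichotomy w z with h | rfl | h
  · have hmono : StrictMonoOn cW (Set.Icc w z) := by
      refine strictMonoOn_of_deriv_pos (convex_Icc _ _)
        (continuousOn_cW.mono fun x hx => Set.mem_Ioi.2 (by linarith [hx.1])) fun x hx => ?_
      rw [interior_Icc] at hx
      have hx1 : 1 < x := by linarith [hx.1]
      rw [(hasDerivAt_cW hx1).deriv]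
      exact mul_pos (hcoef x hx1) (h1 x hx1 hx.2)
    exact (hmono ⟨le_rfl, h.le⟩ ⟨h.le, le_rfl⟩ h).le
  · exact le_rfl
  · have hanti : StrictAntiOn cW (Set.Icc z w) := by
      refine strictAntiOn_of_deriv_neg (convex_Icc _ _)
        (continuousOn_cW.mono fun x hx => Set.mem_Ioi.2 (by linarith [hx.1])) fun x hx => ?_
      rw [interior_Icc] at hx
      have hx1 : 1 < x := by linarith [hx.1]
      rw [(hasDerivAt_cW hx1).deriv]
      exact mul_neg_of_pos_of_neg (hcoef x hx1) (h2 x hx.1)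
    exact (hanti ⟨le_rfl, h.le⟩ ⟨h.le, le_rfl⟩ h).le

/-! ### Numerical enclosures of the zeros and of the critical point. -/

theorem exp_mem_of_taylor {v lo hi : ℝ} (h0 : 0 ≤ v) (h1 : v ≤ 1)
    (hlo : lo ≤ ∑ m ∈ Finset.range 13, v ^ m / m.factorial)
    (hhi : (∑ m ∈ Finset.range 13, v ^ m / m.factorial) + v ^ 13 * 14 / (Nat.factorial 13 * 13) ≤ hi) :
    lo ≤ Real.exp v ∧ Real.exp v ≤ hi := by
  refine ⟨hlo.trans (Real.sum_le_exp_of_nonneg h0 13), le_trans ?_ hhi⟩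
  have := Real.exp_bound' h0 h1 (n := 13) (by norm_num)
  norm_num at this ⊢
  exact this

/-- At `Real.exp v` the logarithm in `phi` is exactly v, so an enclosure of the exponential alone
suffices. -/
theorem phi_exp_le {v lo hi : ℝ} (h1 : 1 < lo) (h : lo ≤ Real.exp v ∧ Real.exp v ≤ hi) :
    phi (Real.exp v) ≤ v - (lo - 1) + 4 * (hi - 1) ^ 4 * (hi + 1) ^ 2 / lo ^ 6 := by
  obtain ⟨hl, hh⟩ := h
  have : 0 ≤ Real.exp v - 1 := by linarith
  rw [phi, Real.log_exp]
  gcongr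

theorem le_phi_exp {v lo hi : ℝ} (h1 : 1 < lo) (h : lo ≤ Real.exp v ∧ Real.exp v ≤ hi) :
    v - (hi - 1) + 4 * (lo - 1) ^ 4 * (lo + 1) ^ 2 / hi ^ 6 ≤ phi (Real.exp v) := by
  obtain ⟨hl, hh⟩ := h
  have : 0 ≤ lo - 1 := by linarith
  rw [phi, Real.log_exp]
  gcongr

theorem phi_exp_27585 : phi (Real.exp 0.27585) < 0 := by
  refine (phi_exp_le (lo := 1.3176502) (hi := 1.3176503) (by norm_num) ?_).trans_lt (by norm_num)
  apply exp_mem_of_taylor <;> norm_num [Finset.sum_range_succ, Nat.factorial]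

theorem phi_exp_2759 : 0 < phi (Real.exp 0.2759) := by
  refine lt_of_lt_of_le ?_ (le_phi_exp (lo := 1.3177160) (hi := 1.3177161) (by norm_num) ?_)
  · norm_num
  apply exp_mem_of_taylor <;> norm_num [Finset.sum_range_succ, Nat.factorial]

/-- The Taylor remainder bound needs an exponent in [0, 1]; larger exponents are halved and the
enclosure squared. -/
theorem exp_two_mul_mem {v lo hi : ℝ} (h0 : 0 ≤ lo) (h : lo ≤ Real.exp v ∧ Real.exp v ≤ hi) :
    lo ^ 2 ≤ Real.exp (2 * v) ∧ Real.exp (2 * v) ≤ hi ^ 2 := by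
  obtain ⟨hl, hh⟩ := h
  have : Real.exp (2 * v) = Real.exp v ^ 2 := by rw [← Real.exp_nat_mul]; norm_num
  rw [this]
  constructor <;> gcongr

theorem phi_exp_15963 : 0 < phi (Real.exp (2 * 0.79815)) := by
  refine lt_of_lt_of_le ?_ (le_phi_exp (lo := 2.22142748 ^ 2) (hi := 2.22142749 ^ 2)
    (by norm_num) (exp_two_mul_mem (by norm_num) ?_))
  · norm_num
  apply exp_mem_of_taylor <;> norm_num [Finset.sum_range_succ, Nat.factorial]

theorem phi_exp_159635 : phi (Real.exp (2 * 0.798175)) < 0 := by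
  refine (phi_exp_le (lo := 2.22148302 ^ 2) (hi := 2.22148303 ^ 2)
    (by norm_num) (exp_two_mul_mem (by norm_num) ?_)).trans_lt (by norm_num)
  apply exp_mem_of_taylor <;> norm_num [Finset.sum_range_succ, Nat.factorial]

theorem exp_851181 : 2.342411607 ≤ Real.exp 0.851181 ∧ Real.exp 0.851181 ≤ 2.342411608 := by
  apply exp_mem_of_taylor <;> norm_num [Finset.sum_range_succ, Nat.factorial]

theorem exp_8511815 : 2.342412778 ≤ Real.exp 0.8511815 ∧ Real.exp 0.8511815 ≤ 2.342412779 := by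
  apply exp_mem_of_taylor <;> norm_num [Finset.sum_range_succ, Nat.factorial]

theorem mNum_exp_851181 : 0 < mNum (Real.exp 0.851181) := by
  obtain ⟨hl, hh⟩ := exp_851181
  have h1 : (2.342411607 - 1 - 0.851181) - (2.342411608 - 1) ^ 2 * (2.342411608 + 1) /
      (2 * (2.342411607 + 2)) + 4 * (2.342411607 - 1) ^ 4 * (2.342411607 + 1) ^ 2 /
      ((2.342411608 + 2) * 2.342411608 ^ 6) ≤ mNum (Real.exp 0.851181) := by
    have : 0 ≤ Real.exp 0.851181 - 1 := by linarith
    rw [mNum, Real.log_exp]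
    gcongr
  exact lt_of_lt_of_le (by norm_num) h1

theorem mNum_exp_8511815 : mNum (Real.exp 0.8511815) < 0 := by
  obtain ⟨hl, hh⟩ := exp_8511815
  have h1 : mNum (Real.exp 0.8511815) ≤
      (2.342412779 - 1 - 0.8511815) - (2.342412778 - 1) ^ 2 * (2.342412778 + 1) /
      (2 * (2.342412779 + 2)) + 4 * (2.342412779 - 1) ^ 4 * (2.342412779 + 1) ^ 2 /
      ((2.342412778 + 2) * 2.342412778 ^ 6) := by
    have : 0 ≤ Real.exp 0.8511815 - 1 := by linarith
    rw [mNum, Real.log_exp]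
    gcongr
  exact lt_of_le_of_lt h1 (by norm_num)

/-- The critical point of `cW` and its location. -/
theorem exists_mNum_eq_zero : ∃ v : ℝ, 0.851181 < v ∧ v < 0.8511815 ∧ mNum (Real.exp v) = 0 := by
  have hc : ContinuousOn (fun v => mNum (Real.exp v)) (Set.Icc 0.851181 0.8511815) :=
    continuousOn_mNum.comp Real.continuous_exp.continuousOn fun x _ => Real.exp_pos x
  obtain ⟨v, hv, hv0⟩ := intermediate_value_Ioo' (by norm_num) hc
    ⟨mNum_exp_8511815, mNum_exp_851181⟩
  exact ⟨v, hv.1, hv.2, hv0⟩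

theorem exists_phi_eq_zero_left : ∃ v : ℝ, 0.27585 < v ∧ v < 0.2759 ∧ phi (Real.exp v) = 0 := by
  have hc : ContinuousOn (fun v => phi (Real.exp v)) (Set.Icc 0.27585 0.2759) :=
    continuousOn_phi.comp Real.continuous_exp.continuousOn fun x _ => Real.exp_pos x
  obtain ⟨v, hv, hv0⟩ := intermediate_value_Ioo (by norm_num) hc ⟨phi_exp_27585, phi_exp_2759⟩
  exact ⟨v, hv.1, hv.2, hv0⟩

theorem exists_phi_eq_zero_right :
    ∃ v : ℝ, 2 * 0.79815 < v ∧ v < 2 * 0.798175 ∧ phi (Real.exp v) = 0 := by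
  have hc : ContinuousOn (fun v => phi (Real.exp v)) (Set.Icc (2 * 0.79815) (2 * 0.798175)) :=
    continuousOn_phi.comp Real.continuous_exp.continuousOn fun x _ => Real.exp_pos x
  obtain ⟨v, hv, hv0⟩ := intermediate_value_Ioo' (by norm_num) hc ⟨phi_exp_159635, phi_exp_15963⟩
  exact ⟨v, hv.1, hv.2, hv0⟩

/-! ### Return from w to τ, and the proof of (a). -/

theorem exp_neg_eq_inv_sq (τ : ℝ) : Real.exp (-τ) = 1 / Real.exp (τ / 2) ^ 2 := by
  rw [← Real.exp_nat_mul, one_div, ← Real.exp_neg]; congr 1; push_cast; ring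

theorem kappa_eq {τ : ℝ} (hτ : 0 < τ) : kappa τ =
    2 * Real.exp (τ / 2) ^ 2 * (Real.exp (τ / 2) - 1 - τ / 2) / (Real.exp (τ / 2) - 1) ^ 2 := by
  have h1 : 1 < Real.exp (τ / 2) := Real.one_lt_exp_iff.2 (by linarith)
  have h2 : Real.exp (τ / 2) - 1 ≠ 0 := by linarith
  rw [kappa, if_neg hτ.ne', abs_of_pos hτ, neg_div, Real.exp_neg]
  field_simp

theorem kappa_lt_iff {τ : ℝ} (hτ : 0 < τ) :
    kappa τ < 8 * (1 - Real.exp (-τ)) ^ 2 ↔ 0 < phi (Real.exp (τ / 2)) := by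
  have h1 : 1 < Real.exp (τ / 2) := Real.one_lt_exp_iff.2 (by linarith)
  have h2 : 0 < Real.exp (τ / 2) - 1 := by linarith
  have hk := kappa_eq hτ
  have hp : phi (Real.exp (τ / 2)) = τ / 2 - (Real.exp (τ / 2) - 1)
    + 4 * (Real.exp (τ / 2) - 1) ^ 4 * (Real.exp (τ / 2) + 1) ^ 2 / Real.exp (τ / 2) ^ 6 := by
    rw [phi, Real.log_exp]
  rw [exp_neg_eq_inv_sq]
  set w := Real.exp (τ / 2)
  have key : 8 * (1 - 1 / w ^ 2) ^ 2 - kappa τ = 2 * w ^ 2 / (w - 1) ^ 2 * phi w := by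
    rw [hk, hp]
    field_simp
    ring
  have hc : 0 < 2 * w ^ 2 / (w - 1) ^ 2 := by positivity
  rw [← sub_pos, key]
  exact mul_pos_iff_of_pos_left hc

theorem cTau_eq {τ : ℝ} (hτ : 0 < τ) : cTau τ = cW (Real.exp (τ / 2)) := by
  have h1 : 1 < Real.exp (τ / 2) := Real.one_lt_exp_iff.2 (by linarith)
  have h2 : 0 < Real.exp (τ / 2) - 1 := by linarith
  have hk := kappa_eq hτ
  rw [cTau, cW, hk, exp_neg_eq_inv_sq, Real.log_exp]
  set w := Real.exp (τ / 2)
  have h3 : 1 - 1 / w ^ 2 = (w - 1) * (w + 1) / w ^ 2 := by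
    field_simp; ring
  rw [h3]
  field_simp
  ring

theorem exists_admissible_interval : ∃ a b : ℝ, a ∈ Set.Ioo (0.5517 : ℝ) 0.5518 ∧
    b ∈ Set.Ioo (3.1926 : ℝ) 3.1927 ∧
      ∀ τ : ℝ, 0 < τ → (kappa τ < 8 * (1 - Real.exp (-τ)) ^ 2 ↔ a < τ ∧ τ < b) := by
  obtain ⟨v, hv1, hv2, hv⟩ := exists_phi_eq_zero_left
  obtain ⟨u, hu1, hu2, hu⟩ := exists_phi_eq_zero_right
  refine ⟨2 * v, 2 * u, ⟨by linarith, by linarith⟩, ⟨by linarith, by linarith⟩, fun τ hτ => ?_⟩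
  have hexp2 : Real.exp 0.2759 ≤ 2 := by
    refine (Real.exp_le_exp.2 (?_ : _ ≤ Real.log 2)).trans (Real.exp_log two_pos).le
    have := Real.log_two_gt_d9
    linarith
  have hexp3 : 2 ≤ Real.exp u := by
    refine (Real.exp_log two_pos).ge.trans (Real.exp_le_exp.2 ?_)
    have := Real.log_two_lt_d9
    linarith
  rw [kappa_lt_iff hτ, phi_pos_iff (Real.one_lt_exp_iff.2 (by linarith)) hexp3 hv hu
    ⟨_, Real.exp_lt_exp.2 hv2, hexp2, phi_exp_2759⟩ (Real.one_lt_exp_iff.2 (by linarith)),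
    Real.exp_lt_exp, Real.exp_lt_exp]
  constructor <;> rintro ⟨h1, h2⟩ <;> constructor <;> linarith

theorem cTau_pos {τ : ℝ} (hτ : 0 < τ) (h : kappa τ < 8 * (1 - Real.exp (-τ)) ^ 2) :
    0 < cTau τ := by
  have h1 : 0 < 1 - Real.exp (-τ) := by
    have := Real.exp_lt_one_iff.2 (show -τ < 0 by linarith)
    linarith
  have h2 : kappa τ / (32 * (1 - Real.exp (-τ))) < (1 - Real.exp (-τ)) / 4 := by
    rw [div_lt_iff₀ (by positivity)]
    nlinarith
  rw [cTau]
  linarith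

theorem exists_isMaxOn_cTau : ∃ τ : ℝ, |τ - 1.7024| < 0.00005 ∧ |cTau τ - 0.1802| < 0.00005 ∧
    0 < τ ∧ kappa τ < 8 * (1 - Real.exp (-τ)) ^ 2 ∧ IsMaxOn cTau (Set.Ioi 0) τ := by
  obtain ⟨a, b, ha, hb, hab⟩ := exists_admissible_interval
  obtain ⟨v, hv1, hv2, hv⟩ := exists_mNum_eq_zero
  have hτ : 0 < 2 * v := by linarith
  have hz1 : 1 < Real.exp v := Real.one_lt_exp_iff.2 (by linarith)
  have hmem : 2.342411607 ≤ Real.exp v ∧ Real.exp v ≤ 2.342412779 :=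
    ⟨exp_851181.1.trans (Real.exp_le_exp.2 hv1.le), (Real.exp_le_exp.2 hv2.le).trans exp_8511815.2⟩
  have hcz : cTau (2 * v) = cW (Real.exp v) := by rw [cTau_eq hτ]; congr 2; ring
  obtain ⟨hl, hh⟩ := hmem
  have h0 : 0 < Real.exp v - 1 := by linarith
  have hlow : (1 - 1 / 2.342411607 ^ 2 - 2.342412779 ^ 4 * (2.342412779 - 1 - 0.851181) /
      (4 * (2.342411607 - 1) ^ 3 * (2.342411607 + 1))) / 2 ≤ cW (Real.exp v) := by
    rw [cW, Real.log_exp]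
    have : 0 ≤ Real.exp v - 1 - v := by linarith
    gcongr
  have hupp : cW (Real.exp v) ≤ (1 - 1 / 2.342412779 ^ 2 -
      2.342411607 ^ 4 * (2.342411607 - 1 - 0.8511815) /
      (4 * (2.342412779 - 1) ^ 3 * (2.342412779 + 1))) / 2 := by
    rw [cW, Real.log_exp]
    have : 0 ≤ Real.exp v - 1 - v := by linarith
    gcongr
  refine ⟨2 * v, ?_, ?_, hτ, ?_, fun τ hτ' => ?_⟩
  · rw [abs_lt]; constructor <;> linarith
  · rw [hcz, abs_lt]
    norm_num at hlow hupp ⊢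
    constructor <;> linarith
  · rw [hab _ hτ]
    constructor <;> linarith [ha.2, hb.1]
  · rw [Set.mem_ofPred_eq, hcz, cTau_eq hτ']
    exact cW_le_of_mNum_eq_zero hz1 hv (Real.one_lt_exp_iff.2 (half_pos hτ'))

/-- In the proof of (ii) this turns α < c(τ)h² into α ≤ h²/4. -/
theorem cTau_le_quarter {τ : ℝ} (hτ : 0 < τ) : cTau τ ≤ 1 / 4 := by
  obtain ⟨t, -, h, -, -, hmax⟩ := exists_isMaxOn_cTau
  have h1 : cTau τ ≤ cTau t := hmax hτ
  rw [abs_lt] at h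
  linarith

/-! ### Inequalities for κ and exponential moments of variables bounded below. -/

theorem sub_one_sub_log_le {w : ℝ} (hw : 1 ≤ w) : 2 * (w - 1 - Real.log w) ≤ (w - 1) ^ 2 := by
  have h := Real.le_log_one_add_of_nonneg (x := w - 1) (by linarith)
  have h1 : w - 1 - (w - 1) ^ 2 / 2 ≤ 2 * (w - 1) / (w - 1 + 2) := by
    rw [le_div_iff₀ (by linarith)]
    nlinarith [pow_nonneg (sub_nonneg.2 hw) 3]
  rw [add_sub_cancel] at h
  linarith

/-- With w = e^{τ/2}, the bound τ/2 ≤ sinh(τ/2) says log w ≤ (w - 1/w)/2. The numerator of κ is then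
at least w(w - 1)² = (w - 1)² + (w - 1)³. -/
theorem one_le_kappa {τ : ℝ} (hτ : 0 < τ) : 1 ≤ kappa τ := by
  have hw : 1 < Real.exp (τ / 2) := Real.one_lt_exp_iff.2 (by linarith)
  have h := Real.self_le_sinh_iff.2 (show 0 ≤ τ / 2 by linarith)
  rw [Real.sinh_eq, Real.exp_neg] at h
  rw [kappa_eq hτ]
  set w := Real.exp (τ / 2)
  have h0 : 0 < w - 1 := by linarith
  rw [le_div_iff₀ (by positivity)]
  have h1 : 2 * w ^ 2 * (w - 1 - (w - w⁻¹) / 2) ≤ 2 * w ^ 2 * (w - 1 - τ / 2) := by gcongr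
  have h2 : 2 * w ^ 2 * (w - 1 - (w - w⁻¹) / 2) = (w - 1) ^ 2 + (w - 1) ^ 3 := by
    field_simp; ring
  have h3 : 0 < (w - 1) ^ 3 := by positivity
  linarith

theorem kappa_mono {u τ : ℝ} (hu : 0 < u) (h : u ≤ τ) : kappa u ≤ kappa τ := by
  have hτ : 0 < τ := hu.trans_le h
  set f : ℝ → ℝ := fun w => 2 * w ^ 2 * (w - 1 - Real.log w) / (w - 1) ^ 2 with hf
  have hk : ∀ x, 0 < x → kappa x = f (Real.exp (x / 2)) := fun x hx => by
    rw [kappa_eq hx, hf]; simp only [Real.log_exp]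
  have hd : ∀ w, 1 < w → HasDerivAt f
      (2 * w * ((w - 1) ^ 2 - 2 * (w - 1 - Real.log w)) / (w - 1) ^ 3) w := by
    intro w hw
    have h0 : w ≠ 0 := by positivity
    have h1 : w - 1 ≠ 0 := by linarith
    have ha := ((hasDerivAt_id w).sub_const 1)
    refine ((((hasDerivAt_pow 2 w).const_mul 2).mul (ha.sub (Real.hasDerivAt_log h0))).div
      (ha.pow 2) (pow_ne_zero 2 h1)).congr_deriv ?_
    simp
    field_simp
    ring
  have hmono : MonotoneOn f (Set.Ioi 1) := by
    refine monotoneOn_of_deriv_nonneg (convex_Ioi _)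
      (fun w hw => (hd w hw).continuousAt.continuousWithinAt) (fun w hw => ?_) fun w hw => ?_
    · rw [interior_Ioi] at hw
      exact (hd w hw).differentiableAt.differentiableWithinAt
    · rw [interior_Ioi, Set.mem_Ioi] at hw
      rw [(hd w hw).deriv]
      have h1 : 0 < w - 1 := by linarith
      have := sub_one_sub_log_le hw.le
      have : 0 ≤ (w - 1) ^ 2 - 2 * (w - 1 - Real.log w) := by linarith
      positivity
  rw [hk u hu, hk τ hτ]
  exact hmono (Real.one_lt_exp_iff.2 (by linarith)) (Real.one_lt_exp_iff.2 (by linarith))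
    (Real.exp_le_exp.2 (by linarith))

/-- For U < 0 this is the definition of κ(-U) together with monotonicity of κ. For U ≥ 0 the left
side is at most (1 - e^{U/2})², and κ ≥ 1. -/
theorem exp_abs_half_sub_le_kappa {τ U : ℝ} (hτ : 0 < τ) (h : -τ ≤ U) :
    2 * (Real.exp (|U| / 2) - 1 - |U| / 2) ≤ kappa τ * (1 - Real.exp (U / 2)) ^ 2 := by
  rcases le_or_gt 0 U with hU | hU
  · rw [abs_of_nonneg hU]
    have h1 := sub_one_sub_log_le (Real.one_le_exp (show 0 ≤ U / 2 by linarith))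
    rw [Real.log_exp] at h1
    have h2 := mul_le_mul_of_nonneg_right (one_le_kappa hτ) (sq_nonneg (1 - Real.exp (U / 2)))
    nlinarith
  · have h1 := kappa_mono (neg_pos.2 hU) (show -U ≤ τ by linarith)
    have h2 : 0 < (1 - Real.exp (U / 2)) ^ 2 := by
      have := Real.exp_lt_one_iff.2 (show U / 2 < 0 by linarith)
      have : 0 < 1 - Real.exp (U / 2) := by linarith
      positivity
    rw [kappa, if_neg (by linarith), neg_neg, abs_neg, div_le_iff₀ h2] at h1
    exact h1

/-- In the power series, s^k ≤ s² for k ≥ 2. The proof differentiates in x and uses convexity of exp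
instead. -/
theorem exp_mul_sub_le {s x : ℝ} (hs0 : 0 ≤ s) (hs1 : s ≤ 1) (hx : 0 ≤ x) :
    Real.exp (s * x) - 1 - s * x ≤ s ^ 2 * (Real.exp x - 1 - x) := by
  set F : ℝ → ℝ := fun x => s ^ 2 * (Real.exp x - 1 - x) - (Real.exp (s * x) - 1 - s * x) with hF
  have hd : ∀ y, HasDerivAt F (s ^ 2 * (Real.exp y - 1) - (Real.exp (s * y) * s - s)) y := by
    intro y
    have h1 := (((Real.hasDerivAt_exp y).sub_const 1).sub (hasDerivAt_id y)).const_mul (s ^ 2)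
    have h2 := (hasDerivAt_id y).const_mul s
    refine (h1.sub ((h2.exp.sub_const 1).sub h2)).congr_deriv ?_
    simp
  have hmono : MonotoneOn F (Set.Ici 0) := by
    refine monotoneOn_of_deriv_nonneg (convex_Ici _)
      (fun w _ => (hd w).continuousAt.continuousWithinAt)
      (fun w _ => (hd w).differentiableAt.differentiableWithinAt) fun y _ => ?_
    rw [(hd y).deriv]
    have hc := convexOn_exp.2 (Set.mem_univ y) (Set.mem_univ 0) hs0 (sub_nonneg.2 hs1) (by ring)
    simp only [smul_eq_mul, mul_zero, add_zero, Real.exp_zero, mul_one] at hc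
    nlinarith
  have := hmono (Set.mem_Ici.2 le_rfl) (Set.mem_Ici.2 hx) hx
  simp [hF] at this
  linarith

theorem exp_sub_le_exp_abs_sub (y : ℝ) : Real.exp y - 1 - y ≤ Real.exp |y| - 1 - |y| := by
  rcases le_total 0 y with h | h
  · rw [abs_of_nonneg h]
  · rw [abs_of_nonpos h]
    have := Real.self_le_sinh_iff.2 (neg_nonneg.2 h)
    rw [Real.sinh_eq, neg_neg] at this
    linarith

/-- The quadratic bound behind Bernstein's inequality for variables bounded below by `-τ`. -/
theorem exp_mul_le_of_neg_le {τ U t : ℝ} (hτ : 0 < τ) (h : -τ ≤ U) (ht0 : 0 ≤ t) (ht : t ≤ 1 / 2) :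
    Real.exp (t * U) ≤ 1 + t * U + 2 * t ^ 2 * kappa τ * (1 - Real.exp (U / 2)) ^ 2 := by
  have h1 := exp_sub_le_exp_abs_sub (t * U)
  have h2 := exp_mul_sub_le (s := 2 * t) (by linarith) (by linarith) (show 0 ≤ |U| / 2 by positivity)
  have h3 := exp_abs_half_sub_le_kappa hτ h
  rw [abs_mul, abs_of_nonneg ht0] at h1
  rw [show 2 * t * (|U| / 2) = t * |U| by ring] at h2
  nlinarith [mul_le_mul_of_nonneg_left h3 (sq_nonneg t)]

/-! ### The smoothed density ratio and its logarithm. -/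

/-- The convex combination `e^{-τ} + (1 - e^{-τ}) ρ` of the density ratios `1` and `ρ`. -/
noncomputable def mixRatio (τ ρ : ℝ) : ℝ := Real.exp (-τ) + (1 - Real.exp (-τ)) * ρ

theorem exp_neg_mem {τ : ℝ} (hτ : 0 < τ) : 0 < Real.exp (-τ) ∧ Real.exp (-τ) < 1 :=
  ⟨Real.exp_pos _, Real.exp_lt_one_iff.2 (by linarith)⟩

theorem exp_neg_le_mixRatio {τ ρ : ℝ} (hτ : 0 < τ) (hρ : 0 ≤ ρ) :
    Real.exp (-τ) ≤ mixRatio τ ρ := by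
  have := mul_nonneg (sub_nonneg.2 (exp_neg_mem hτ).2.le) hρ
  unfold mixRatio; linarith

theorem mixRatio_pos {τ ρ : ℝ} (hτ : 0 < τ) (hρ : 0 ≤ ρ) : 0 < mixRatio τ ρ :=
  (Real.exp_pos _).trans_le (exp_neg_le_mixRatio hτ hρ)

theorem mixRatio_mono {τ ρ ρ' : ℝ} (hτ : 0 < τ) (h : ρ ≤ ρ') : mixRatio τ ρ ≤ mixRatio τ ρ' := by
  have := mul_le_mul_of_nonneg_left h (sub_nonneg.2 (exp_neg_mem hτ).2.le)
  unfold mixRatio; linarith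

/-- The logarithm of the smoothed density ratio. -/
noncomputable def logMix (τ ρ : ℝ) : ℝ := Real.log (mixRatio τ ρ)

theorem neg_le_logMix {τ ρ : ℝ} (hτ : 0 < τ) (hρ : 0 ≤ ρ) : -τ ≤ logMix τ ρ :=
  (Real.le_log_iff_exp_le (mixRatio_pos hτ hρ)).2 (exp_neg_le_mixRatio hτ hρ)

theorem logMix_mono {τ ρ ρ' : ℝ} (hτ : 0 < τ) (hρ : 0 ≤ ρ) (h : ρ ≤ ρ') :
    logMix τ ρ ≤ logMix τ ρ' :=
  Real.log_le_log (mixRatio_pos hτ hρ) (mixRatio_mono hτ h)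

theorem exp_half_logMix {τ ρ : ℝ} (hτ : 0 < τ) (hρ : 0 ≤ ρ) :
    Real.exp (logMix τ ρ / 2) = √(mixRatio τ ρ) := by
  rw [Real.exp_half, logMix, Real.exp_log (mixRatio_pos hτ hρ)]

/-- Concavity of the logarithm. This transfers upper bounds from the smoothed to the true
log-likelihood ratio. -/
theorem mul_log_le_logMix {τ ρ : ℝ} (hτ : 0 < τ) (hρ : 0 < ρ) :
    (1 - Real.exp (-τ)) * Real.log ρ ≤ logMix τ ρ := by
  have h := strictConcaveOn_log_Ioi.concaveOn.2 (Set.mem_Ioi.2 one_pos) (Set.mem_Ioi.2 hρ)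
    (exp_neg_mem hτ).1.le (sub_nonneg.2 (exp_neg_mem hτ).2.le) (by ring)
  simpa [logMix, mixRatio] using h

theorem logMix_le {τ ρ : ℝ} (hτ : 0 < τ) (hρ : 0 ≤ ρ) :
    logMix τ ρ ≤ 2 * (√(mixRatio τ ρ) - 1) := by
  have h := Real.log_le_sub_one_of_pos (Real.sqrt_pos.2 (mixRatio_pos hτ hρ))
  rw [Real.log_sqrt (mixRatio_pos hτ hρ).le] at h
  unfold logMix; linarith

/-- With A² = `mixRatio τ r`, B² = `mixRatio τ l` and λ = 1 - e^{-τ}, one has A² - B² = λ(r - l) and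
A + B ≥ √λ(√r + √l). -/
theorem sqrt_mixRatio_sub_le {τ l r : ℝ} (hτ : 0 < τ) (hl : 0 ≤ l) (h : l ≤ r) :
    √(mixRatio τ r) - √(mixRatio τ l) ≤ √(1 - Real.exp (-τ)) * (√r - √l) := by
  obtain ⟨he0, he1⟩ := exp_neg_mem hτ
  have hr : 0 ≤ r := hl.trans h
  have hlam : 0 ≤ 1 - Real.exp (-τ) := by linarith
  have e1 := Real.sq_sqrt (mixRatio_pos hτ hl).le
  have e2 := Real.sq_sqrt (mixRatio_pos hτ hr).le
  have e3 := Real.sq_sqrt hl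
  have e4 := Real.sq_sqrt hr
  have e5 := Real.sq_sqrt hlam
  have g1 : ∀ x, 0 ≤ x → √(1 - Real.exp (-τ)) * √x ≤ √(mixRatio τ x) := fun x hx => by
    rw [← Real.sqrt_mul hlam]
    refine Real.sqrt_le_sqrt ?_
    unfold mixRatio; linarith
  have g2 := g1 l hl
  have g3 := g1 r hr
  have g4 : 0 < √(mixRatio τ l) := Real.sqrt_pos.2 (mixRatio_pos hτ hl)
  have g5 : √(mixRatio τ l) ≤ √(mixRatio τ r) := Real.sqrt_le_sqrt (mixRatio_mono hτ h)
  set A := √(mixRatio τ r)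
  set B := √(mixRatio τ l)
  set s := √(1 - Real.exp (-τ))
  have key : (A - B) * (A + B) = s * (√r - √l) * (s * √r + s * √l) := by
    have : (A - B) * (A + B) = A ^ 2 - B ^ 2 := by ring
    rw [this, e1, e2]
    have : s * (√r - √l) * (s * √r + s * √l) = s ^ 2 * (√r ^ 2 - √l ^ 2) := by ring
    rw [this, e3, e4, e5]
    unfold mixRatio; ring
  have hs : 0 ≤ s * (√r - √l) :=
    mul_nonneg (Real.sqrt_nonneg _) (sub_nonneg.2 (Real.sqrt_le_sqrt h))
  have h1 : (A - B) * (A + B) ≤ s * (√r - √l) * (A + B) := by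
    rw [key]; gcongr
  exact le_of_mul_le_mul_right h1 (by linarith)

theorem sq_sqrt_mixRatio_sub_le {τ l r : ℝ} (hτ : 0 < τ) (hl : 0 ≤ l) (hr : 0 ≤ r) :
    (√(mixRatio τ r) - √(mixRatio τ l)) ^ 2 ≤ (1 - Real.exp (-τ)) * (√r - √l) ^ 2 := by
  wlog h : l ≤ r generalizing l r
  · have := this hr hl (le_of_not_ge h)
    nlinarith
  have h1 := sqrt_mixRatio_sub_le hτ hl h
  have h2 : √(mixRatio τ l) ≤ √(mixRatio τ r) := Real.sqrt_le_sqrt (mixRatio_mono hτ h)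
  have h3 : 0 ≤ √(mixRatio τ r) - √(mixRatio τ l) := by linarith
  calc _ ≤ (√(1 - Real.exp (-τ)) * (√r - √l)) ^ 2 := by gcongr
    _ = _ := by rw [mul_pow, Real.sq_sqrt (by linarith [(exp_neg_mem hτ).2])]

theorem mixRatio_one (τ : ℝ) : mixRatio τ 1 = 1 := by unfold mixRatio; ring

theorem sq_sqrt_mixRatio_sub_one_le {τ ρ : ℝ} (hτ : 0 < τ) (hρ : 0 ≤ ρ) :
    (√(mixRatio τ ρ) - 1) ^ 2 ≤ (1 - Real.exp (-τ)) * (√ρ - 1) ^ 2 := by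
  simpa [mixRatio_one] using sq_sqrt_mixRatio_sub_le hτ zero_le_one hρ

/-- With A = √`mixRatio τ ρ` and R = √ρ, (A - 1)(A + 1) = (1 - e^{-τ})(R - 1)(R + 1), while A ≤ R +
1 gives A + 1 ≤ 2(R + 1). -/
theorem le_sq_sqrt_mixRatio_sub_one {τ ρ : ℝ} (hτ : 0 < τ) (hρ : 0 ≤ ρ) :
    (1 - Real.exp (-τ)) ^ 2 / 4 * (√ρ - 1) ^ 2 ≤ (√(mixRatio τ ρ) - 1) ^ 2 := by
  obtain ⟨he0, he1⟩ := exp_neg_mem hτ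
  have e1 := Real.sq_sqrt (mixRatio_pos hτ hρ).le
  have e2 := Real.sq_sqrt hρ
  have hA := Real.sqrt_nonneg (mixRatio τ ρ)
  have hR := Real.sqrt_nonneg ρ
  have h1 : √(mixRatio τ ρ) ≤ √ρ + 1 := by
    rw [Real.sqrt_le_left (by linarith), add_sq, e2]
    unfold mixRatio
    nlinarith
  set A := √(mixRatio τ ρ)
  set R := √ρ
  have key : (A - 1) * (A + 1) = (1 - Real.exp (-τ)) * (R - 1) * (R + 1) := by
    have : (A - 1) * (A + 1) = A ^ 2 - 1 := by ring
    rw [this, e1]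
    have : (1 - Real.exp (-τ)) * (R - 1) * (R + 1) = (1 - Real.exp (-τ)) * (R ^ 2 - 1) := by ring
    rw [this, e2]
    unfold mixRatio; ring
  have h2 : (A - 1) ^ 2 * (A + 1) ^ 2 = ((1 - Real.exp (-τ)) * (R - 1)) ^ 2 * (R + 1) ^ 2 := by
    rw [← mul_pow, key, mul_pow]
  have h3 : (A + 1) ^ 2 ≤ 4 * (R + 1) ^ 2 := by nlinarith
  have h4 : ((1 - Real.exp (-τ)) * (R - 1)) ^ 2 * (R + 1) ^ 2 ≤ (4 * (A - 1) ^ 2) * (R + 1) ^ 2 := by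
    rw [← h2]
    nlinarith [mul_le_mul_of_nonneg_left h3 (sq_nonneg (A - 1))]
  have h5 := le_of_mul_le_mul_right h4 (by positivity)
  rw [mul_pow] at h5
  linarith

/-- From log(A/B) ≤ (A - B)/B applied to square roots; smoothing keeps the denominator above
e^{-τ/2}. -/
theorem logMix_sub_le {τ l r : ℝ} (hτ : 0 < τ) (hl : 0 ≤ l) (h : l ≤ r) :
    logMix τ r - logMix τ l ≤
      2 * Real.exp (τ / 2) * √(1 - Real.exp (-τ)) * (√r - √l) := by
  have hr := hl.trans h
  have hB : Real.exp (-τ / 2) ≤ √(mixRatio τ l) := by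
    rw [← exp_half_logMix hτ hl]
    exact Real.exp_le_exp.2 (by linarith [neg_le_logMix hτ hl])
  have hA0 : 0 < √(mixRatio τ r) := Real.sqrt_pos.2 (mixRatio_pos hτ hr)
  have hB0 : 0 < √(mixRatio τ l) := Real.sqrt_pos.2 (mixRatio_pos hτ hl)
  have h1 := Real.log_le_sub_one_of_pos (div_pos hA0 hB0)
  rw [Real.log_div hA0.ne' hB0.ne', Real.log_sqrt (mixRatio_pos hτ hr).le,
    Real.log_sqrt (mixRatio_pos hτ hl).le, div_sub_one hB0.ne'] at h1
  have h2 := sqrt_mixRatio_sub_le hτ hl h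
  have h0 : 0 ≤ √(1 - Real.exp (-τ)) * (√r - √l) :=
    mul_nonneg (Real.sqrt_nonneg _) (sub_nonneg.2 (Real.sqrt_le_sqrt h))
  have h3 : (√(mixRatio τ r) - √(mixRatio τ l)) / √(mixRatio τ l) ≤
      √(1 - Real.exp (-τ)) * (√r - √l) / Real.exp (-τ / 2) := by gcongr
  rw [neg_div, Real.exp_neg (τ / 2), div_inv_eq_mul] at h3
  unfold logMix
  linarith

theorem kappa_mul_exp_neg_le {τ : ℝ} (hτ : 0 < τ)
    (h : kappa τ < 8 * (1 - Real.exp (-τ)) ^ 2) : kappa τ * Real.exp (-τ) ≤ 32 / 27 := by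
  obtain ⟨he0, he1⟩ := exp_neg_mem hτ
  set e := Real.exp (-τ)
  -- The maximum of 8e(1 - e)² on [0, 1] is 32/27, at e = 1/3: the product equals 4/27 - e(1 - e)².
  nlinarith [mul_nonneg (sq_nonneg (e - 1 / 3)) (show 0 ≤ 4 / 3 - e by linarith)]

/-! ### Tail bounds and one-sided chaining with upper brackets. -/

section Tails

variable {Ω S : Type*}

/-- The running minimum of a sequence of functions. -/
def runMin (f : ℕ → S → ℝ) : ℕ → S → ℝ
  | 0 => f 0
  | j + 1 => fun z => min (runMin f j z) (f (j + 1) z)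

open Classical in
/-- The running minima of sequences with `j`-th term in `F j`. -/
noncomputable def runMinFinset (F : ℕ → Finset (S → ℝ)) : ℕ → Finset (S → ℝ)
  | 0 => F 0
  | j + 1 => Finset.image₂ (fun v f z => min (v z) (f z)) (runMinFinset F j) (F (j + 1))

theorem runMin_mem {F : ℕ → Finset (S → ℝ)} {f : ℕ → S → ℝ} {J : ℕ} (h : ∀ j ≤ J, f j ∈ F j) :
    ∀ j ≤ J, runMin f j ∈ runMinFinset F j := by
  classical
  intro j
  induction j with
  | zero => exact h 0
  | succ j ih =>
    intro hj
    exact Finset.mem_image₂_of_mem (ih (by omega)) (h _ hj)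

theorem card_runMinFinset_le (F : ℕ → Finset (S → ℝ)) (j : ℕ) :
    (runMinFinset F j).card ≤ ∏ i ∈ Finset.range (j + 1), (F i).card := by
  classical
  induction j with
  | zero => simp [runMinFinset]
  | succ j ih =>
    rw [Finset.prod_range_succ]
    exact (Finset.card_image₂_le _ _ _).trans (Nat.mul_le_mul_right _ ih)

theorem runMin_le (f : ℕ → S → ℝ) (j : ℕ) (z : S) : runMin f j z ≤ f j z := by
  cases j with
  | zero => exact le_rfl
  | succ j => exact min_le_right _ _

theorem le_runMin {f : ℕ → S → ℝ} {g : S → ℝ} {J : ℕ} (h : ∀ j ≤ J, ∀ z, g z ≤ f j z) :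
    ∀ j ≤ J, ∀ z, g z ≤ runMin f j z := by
  intro j
  induction j with
  | zero => exact h 0
  | succ j ih => exact fun hj z => le_min (ih (by omega) z) (h _ hj z)

variable [MeasurableSpace Ω] [MeasurableSpace S] {μ : Measure Ω} {ρ : Measure S}
  {n : ℕ} {Z : Fin n → Ω → S}

/-- Chernoff's bound for an i.i.d. sample. -/
theorem measure_le_sum_le_exp (hZ : ∀ i, Measurable (Z i)) (hind : iIndepFun Z μ)
    (hmap : ∀ i, μ.map (Z i) = ρ) {f : S → ℝ} (hf : Measurable f)
    (hint : Integrable (fun z => Real.exp (f z)) ρ) {b : ℝ}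
    (hb : ∫ z, Real.exp (f z) ∂ρ ≤ Real.exp b) (a : ℝ) :
    μ {ω | n * a ≤ ∑ i, f (Z i ω)} ≤ ENNReal.ofReal (Real.exp (n * (b - a))) := by
  have hE : Measurable fun z => ENNReal.ofReal (Real.exp (f z)) :=
    (Real.measurable_exp.comp hf).ennreal_ofReal
  have hprod : ∫⁻ ω, ∏ i, ENNReal.ofReal (Real.exp (f (Z i ω))) ∂μ ≤
      ENNReal.ofReal (Real.exp b) ^ n := by
    rw [lintegral_prod_eq_prod_lintegral_of_indepFun Finset.univ
      (fun i ω => ENNReal.ofReal (Real.exp (f (Z i ω))))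
      (hind.comp (fun _ z => ENNReal.ofReal (Real.exp (f z))) fun _ => hE)
      fun i => hE.comp (hZ i)]
    have : ∀ i, ∫⁻ ω, ENNReal.ofReal (Real.exp (f (Z i ω))) ∂μ ≤ ENNReal.ofReal (Real.exp b) := by
      intro i
      rw [← lintegral_map hE (hZ i), hmap i, ← ofReal_integral_eq_lintegral_ofReal hint
        (Filter.Eventually.of_forall fun z => (Real.exp_pos _).le)]
      exact ENNReal.ofReal_le_ofReal hb
    calc _ ≤ ∏ _i : Fin n, ENNReal.ofReal (Real.exp b) := Finset.prod_le_prod' fun i _ => this i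
      _ = _ := by simp
  have hsub : {ω | n * a ≤ ∑ i, f (Z i ω)} ⊆
      {ω | ENNReal.ofReal (Real.exp (n * a)) ≤ ∏ i, ENNReal.ofReal (Real.exp (f (Z i ω)))} := by
    intro ω hω
    simp only [Set.mem_ofPred_eq] at hω ⊢
    rw [← ENNReal.ofReal_prod_of_nonneg fun i _ => (Real.exp_pos _).le, ← Real.exp_sum]
    exact ENNReal.ofReal_le_ofReal (Real.exp_le_exp.2 hω)
  have hM : Measurable fun ω => ∏ i, ENNReal.ofReal (Real.exp (f (Z i ω))) :=
    Finset.measurable_fun_prod _ fun i _ => hE.comp (hZ i)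
  have hmk := (mul_meas_ge_le_lintegral hM (ENNReal.ofReal (Real.exp (n * a)))).trans hprod
  have h1 : ENNReal.ofReal (Real.exp b) ^ n =
      ENNReal.ofReal (Real.exp (n * a)) * ENNReal.ofReal (Real.exp (n * (b - a))) := by
    rw [← ENNReal.ofReal_pow (Real.exp_pos _).le, ← ENNReal.ofReal_mul (Real.exp_pos _).le,
      ← Real.exp_add, ← Real.exp_nat_mul]
    congr 2; ring
  rw [h1] at hmk
  refine (measure_mono hsub).trans ?_
  refine (ENNReal.mul_le_mul_iff_right ?_ ENNReal.ofReal_ne_top).1 hmk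
  simpa using Real.exp_pos _

theorem exp_neg_le_quadratic {y : ℝ} (hy : 0 ≤ y) : Real.exp (-y) ≤ 1 - y + y ^ 2 / 2 := by
  have h := Real.quadratic_le_exp_of_nonneg hy
  have h0 : 0 < 1 + y + y ^ 2 / 2 := by positivity
  rw [Real.exp_neg]
  refine (inv_anti₀ h0 h).trans ?_
  rw [inv_le_iff_one_le_mul₀ h0]
  nlinarith [sq_nonneg (y ^ 2)]

/-- The lower tail of a mean of nonnegative variables is sub-Gaussian. -/
theorem measure_lower_tail_le [IsProbabilityMeasure ρ] (hZ : ∀ i, Measurable (Z i))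
    (hind : iIndepFun Z μ) (hmap : ∀ i, μ.map (Z i) = ρ) {W : S → ℝ} (hW : Measurable W)
    (hW0 : ∀ z, 0 ≤ W z) (hi : Integrable W ρ) (hi2 : Integrable (fun z => W z ^ 2) ρ) {v x : ℝ}
    (hv : 0 < v) (hle : ∫ z, W z ^ 2 ∂ρ ≤ v) (hx : 0 ≤ x) :
    μ {ω | n * x ≤ ∑ i, ((∫ z, W z ∂ρ) - W (Z i ω))} ≤
      ENNReal.ofReal (Real.exp (-(n * x ^ 2 / (2 * v)))) := by
  set m := ∫ z, W z ∂ρ with hm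
  -- This s minimizes the Chernoff exponent -sx + s²v/2.
  set s := x / v with hs
  have hs0 : 0 ≤ s := by positivity
  have hmeas : Measurable fun z => s * (m - W z) := (hW.const_sub m).const_mul s
  have hexp : ∀ z, Real.exp (s * (m - W z)) ≤
      Real.exp (s * m) * (1 - s * W z + s ^ 2 / 2 * W z ^ 2) := by
    intro z
    rw [mul_sub, sub_eq_add_neg, Real.exp_add]
    have := exp_neg_le_quadratic (mul_nonneg hs0 (hW0 z))
    have h2 : 1 - s * W z + (s * W z) ^ 2 / 2 = 1 - s * W z + s ^ 2 / 2 * W z ^ 2 := by ring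
    rw [h2] at this
    gcongr
  have hI0 : Integrable (fun z => 1 - s * W z) ρ := (integrable_const _).sub (hi.const_mul s)
  have hI : Integrable (fun z => 1 - s * W z + s ^ 2 / 2 * W z ^ 2) ρ := hI0.add (hi2.const_mul _)
  have hI' : Integrable (fun z => Real.exp (s * (m - W z))) ρ := by
    refine (hI.const_mul (Real.exp (s * m))).mono' (Real.measurable_exp.comp hmeas).aestronglyMeasurable
      (Filter.Eventually.of_forall fun z => ?_)
    rw [Real.norm_eq_abs, Real.abs_exp]
    exact hexp z
  have hb : ∫ z, Real.exp (s * (m - W z)) ∂ρ ≤ Real.exp (s ^ 2 / 2 * v) := by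
    calc _ ≤ ∫ z, Real.exp (s * m) * (1 - s * W z + s ^ 2 / 2 * W z ^ 2) ∂ρ :=
          integral_mono hI' (hI.const_mul _) hexp
      _ = Real.exp (s * m) * (1 - s * m + s ^ 2 / 2 * ∫ z, W z ^ 2 ∂ρ) := by
          rw [integral_const_mul, integral_add hI0 (hi2.const_mul _), integral_sub (integrable_const _) (hi.const_mul s),
            integral_const_mul, integral_const_mul]
          simp [hm]
      _ ≤ Real.exp (s * m) * Real.exp (-(s * m) + s ^ 2 / 2 * v) := by
          gcongr
          have h1 := Real.add_one_le_exp (-(s * m) + s ^ 2 / 2 * v)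
          have h2 : s ^ 2 / 2 * ∫ z, W z ^ 2 ∂ρ ≤ s ^ 2 / 2 * v := by gcongr
          linarith
      _ = _ := by rw [← Real.exp_add]; congr 1; ring
  have h := measure_le_sum_le_exp hZ hind hmap hmeas hI' hb (s * x)
  refine (measure_mono fun ω hω => ?_).trans (h.trans (le_of_eq ?_))
  · simp only [Set.mem_ofPred_eq] at hω ⊢
    rw [← Finset.mul_sum]
    nlinarith [mul_le_mul_of_nonneg_left hω hs0]
  · congr 2
    rw [hs]
    field_simp
    ring

/-- Chernoff's bound in the form used for the coarsest level of a chain. -/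
theorem measure_upper_tail_le (hZ : ∀ i, Measurable (Z i))
    (hind : iIndepFun Z μ) (hmap : ∀ i, μ.map (Z i) = ρ) {U : S → ℝ} (hU : Measurable U) {t m : ℝ}
    (ht : 0 < t) (hi : Integrable (fun z => Real.exp (t * U z)) ρ)
    (hle : ∫ z, Real.exp (t * U z) ∂ρ ≤ Real.exp (t * m)) (x : ℝ) :
    μ {ω | n * (m + x) ≤ ∑ i, U (Z i ω)} ≤ ENNReal.ofReal (Real.exp (-(n * (t * x)))) := by
  have h := measure_le_sum_le_exp hZ hind hmap (hU.const_mul t) hi hle (t * (m + x))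
  refine (measure_mono fun ω hω => ?_).trans (h.trans (le_of_eq ?_))
  · simp only [Set.mem_ofPred_eq] at hω ⊢
    rw [← Finset.mul_sum]
    nlinarith [mul_le_mul_of_nonneg_left hω ht.le]
  · congr 2
    ring

/-- Union bound over the values that k takes, finitely many even if the index type is uncountable.
Everything is outer measure, so no measurability in p is needed. -/
theorem measure_exists_le_card_mul {ι T : Type*} (K : Finset T) (k : ι → T) (hk : ∀ p, k p ∈ K)
    (A : T → Set Ω) {e : ℝ≥0∞} (hA : ∀ p, μ (A (k p)) ≤ e) :
    μ {ω | ∃ p, ω ∈ A (k p)} ≤ K.card * e := by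
  classical
  set K' := K.filter fun s => ∃ p, k p = s
  have hsub : {ω | ∃ p, ω ∈ A (k p)} ⊆ ⋃ s ∈ K', A s := by
    rintro ω ⟨p, hp⟩
    simp only [Set.mem_iUnion]
    exact ⟨k p, Finset.mem_filter.2 ⟨hk p, p, rfl⟩, hp⟩
  calc _ ≤ ∑ s ∈ K', μ (A s) := (measure_mono hsub).trans (measure_biUnion_finset_le _ _)
    _ ≤ ∑ s ∈ K', e := Finset.sum_le_sum fun s hs => by
        obtain ⟨-, p, rfl⟩ := Finset.mem_filter.1 hs
        exact hA p
    _ = K'.card * e := by simp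
    _ ≤ _ := by gcongr; exact Finset.filter_subset _ _

theorem measurable_runMin {f : ℕ → S → ℝ} {J : ℕ} (h : ∀ j ≤ J, Measurable (f j)) :
    ∀ j ≤ J, Measurable (runMin f j) := by
  intro j
  induction j with
  | zero => exact h 0
  | succ j ih => exact fun hj => (ih (by omega)).min (h _ hj)

theorem integrable_runMin {f : ℕ → S → ℝ} {J : ℕ} (h : ∀ j ≤ J, Integrable (f j) ρ) :
    ∀ j ≤ J, Integrable (runMin f j) ρ := by
  intro j
  induction j with
  | zero => exact h 0
  | succ j ih => exact fun hj => (ih (by omega)).inf (h _ hj)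

/-- A one-sided chaining bound with upper brackets `r p j` of `g p`. -/
theorem measure_chain_le [IsProbabilityMeasure ρ] (hZ : ∀ i, Measurable (Z i))
    (hind : iIndepFun Z μ) (hmap : ∀ i, μ.map (Z i) = ρ) {ι : Type*} {J : ℕ}
    {g : ι → S → ℝ} {r : ι → ℕ → S → ℝ} {F : ℕ → Finset (S → ℝ)} {u : ℕ → ℝ}
    (hrF : ∀ p, ∀ j ≤ J, r p j ∈ F j)
    (hg : ∀ p, Integrable (g p) ρ)
    (hrm : ∀ p, ∀ j ≤ J, Measurable (r p j)) (hri : ∀ p, ∀ j ≤ J, Integrable (r p j) ρ)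
    (hgr : ∀ p, ∀ j ≤ J, ∀ z, g p z ≤ r p j z)
    (hsq : ∀ p, ∀ j ≤ J, Integrable (fun z => (r p j z - g p z) ^ 2) ρ)
    (hu : ∀ j ≤ J, 0 < u j)
    (hsqle : ∀ p, ∀ j ≤ J, ∫ z, (r p j z - g p z) ^ 2 ∂ρ ≤ u j ^ 2)
    {t : ℝ} (ht : 0 < t) {b : (S → ℝ) → ℝ}
    (hexpi : ∀ p, Integrable (fun z => Real.exp (t * r p 0 z)) ρ)
    (hexp : ∀ p, ∫ z, Real.exp (t * r p 0 z) ∂ρ ≤ Real.exp (t * ((∫ z, r p 0 z ∂ρ) + b (r p 0))))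
    (x₀ : ℝ) {x : ℕ → ℝ} (hx : ∀ j < J, 0 ≤ x j) :
    μ {ω | ∃ p, n * ((∫ z, g p z ∂ρ) + u J + b (r p 0) + x₀ + ∑ j ∈ Finset.range J, x j)
        ≤ ∑ i, g p (Z i ω)} ≤
      (F 0).card * ENNReal.ofReal (Real.exp (-(n * (t * x₀)))) +
      ∑ j ∈ Finset.range J, (∏ i ∈ Finset.range (j + 2), (F i).card : ℕ) *
        ENNReal.ofReal (Real.exp (-(n * x j ^ 2 / (2 * u j ^ 2)))) := by
  classical
  set A₀ : (S → ℝ) → Set Ω := fun f => {ω | n * (((∫ z, f z ∂ρ) + b f) + x₀) ≤ ∑ i, f (Z i ω)}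
  set A : ℕ → (S → ℝ) × (S → ℝ) → Set Ω := fun j f => {ω | n * x j ≤
    ∑ i, ((∫ z, (f.1 z - min (f.1 z) (f.2 z)) ∂ρ) - (f.1 (Z i ω) - min (f.1 (Z i ω)) (f.2 (Z i ω))))}
  have h0 : μ {ω | ∃ p, ω ∈ A₀ (r p 0)} ≤
      (F 0).card * ENNReal.ofReal (Real.exp (-(n * (t * x₀)))) :=
    measure_exists_le_card_mul (F 0) (fun p => r p 0) (fun p => hrF p 0 (Nat.zero_le _)) A₀
      fun p => measure_upper_tail_le hZ hind hmap (hrm p 0 (Nat.zero_le _)) ht (hexpi p) (hexp p) x₀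
  have hV := fun p => runMin_mem (hrF p)
  have hVg := fun p => le_runMin (hgr p)
  have hVm := fun p => measurable_runMin (hrm p)
  have hVi := fun p => integrable_runMin (hri p)
  have h1 : ∀ j < J, μ {ω | ∃ p, ω ∈ A j (runMin (r p) j, r p (j + 1))} ≤
      (∏ i ∈ Finset.range (j + 2), (F i).card : ℕ) *
        ENNReal.ofReal (Real.exp (-(n * x j ^ 2 / (2 * u j ^ 2)))) := by
    intro j hj
    refine (measure_exists_le_card_mul (runMinFinset F j ×ˢ F (j + 1))
      (fun p => (runMin (r p) j, r p (j + 1)))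
      (fun p => Finset.mk_mem_product (hV p j hj.le) (hrF p _ hj)) (A j)
      (e := ENNReal.ofReal (Real.exp (-(n * x j ^ 2 / (2 * u j ^ 2))))) fun p => ?_).trans ?_
    -- The drop of the running minimum lies between 0 and `r p j - g p`, since the next minimum
    -- still dominates `g p`. Its second moment is therefore at most `u j ^ 2`.
    · have hW : ∀ z, runMin (r p) j z - min (runMin (r p) j z) (r p (j + 1) z) ≤ r p j z - g p z :=
        fun z => sub_le_sub (runMin_le _ _ _) (hVg p (j + 1) hj z)
      have hW0 : ∀ z, 0 ≤ runMin (r p) j z - min (runMin (r p) j z) (r p (j + 1) z) :=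
        fun z => sub_nonneg.2 (min_le_left _ _)
      have hWm : Measurable fun z => runMin (r p) j z - min (runMin (r p) j z) (r p (j + 1) z) :=
        (hVm p j hj.le).sub (hVm p (j + 1) hj)
      have hle2 : ∀ z, (runMin (r p) j z - min (runMin (r p) j z) (r p (j + 1) z)) ^ 2 ≤
          (r p j z - g p z) ^ 2 := fun z => pow_le_pow_left₀ (hW0 z) (hW z) 2
      have hi2 : Integrable
          (fun z => (runMin (r p) j z - min (runMin (r p) j z) (r p (j + 1) z)) ^ 2) ρ := by
        refine (hsq p j hj.le).mono' (hWm.pow_const 2).aestronglyMeasurable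
          (Filter.Eventually.of_forall fun z => ?_)
        rw [Real.norm_eq_abs, abs_of_nonneg (sq_nonneg _)]
        exact hle2 z
      exact measure_lower_tail_le hZ hind hmap hWm hW0 ((hVi p j hj.le).sub (hVi p (j + 1) hj)) hi2
        (by have := hu j hj.le; positivity)
        ((integral_mono hi2 (hsq p j hj.le) hle2).trans (hsqle p j hj.le)) (hx j hj)
    · gcongr
      rw [Finset.card_product, Finset.prod_range_succ]
      exact Nat.mul_le_mul_right _ (card_runMinFinset_le F j)
  have hsub : {ω | ∃ p, n * ((∫ z, g p z ∂ρ) + u J + b (r p 0) + x₀ + ∑ j ∈ Finset.range J, x j)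
        ≤ ∑ i, g p (Z i ω)} ⊆ {ω | ∃ p, ω ∈ A₀ (r p 0)} ∪
      ⋃ j ∈ Finset.range J, {ω | ∃ p, ω ∈ A j (runMin (r p) j, r p (j + 1))} := by
    rintro ω ⟨p, hp⟩
    by_contra hcon
    simp only [Set.mem_union, Set.mem_iUnion, Finset.mem_range, not_or, not_exists,
      Set.mem_ofPred_eq, A₀, A, not_le, exists_prop, not_and] at hcon
    obtain ⟨hc0, hc1⟩ := hcon
    have hc0 := hc0 p
    have hc1 := fun j hj => hc1 j hj p
    have htel : ∀ k ≤ J, ∑ i, runMin (r p) k (Z i ω) <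
        n * ((∫ z, runMin (r p) k z ∂ρ) + b (r p 0) + x₀ + ∑ j ∈ Finset.range k, x j) := by
      intro k
      induction k with
      | zero => intro _; simpa [runMin] using hc0
      | succ k ih =>
        intro hk
        have h2 := ih (by omega)
        have h3 := hc1 k hk
        have h3' : ∫ z, (runMin (r p) k z - min (runMin (r p) k z) (r p (k + 1) z)) ∂ρ =
            (∫ z, runMin (r p) k z ∂ρ) - ∫ z, min (runMin (r p) k z) (r p (k + 1) z) ∂ρ :=
          integral_sub (hVi p k (by omega)) (hVi p (k + 1) hk)
        rw [Finset.sum_sub_distrib, Finset.sum_sub_distrib, h3'] at h3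
        simp only [Finset.sum_const, Finset.card_univ, Fintype.card_fin, nsmul_eq_mul] at h3
        rw [Finset.sum_range_succ]
        simp only [runMin] at h2 h3 ⊢
        linarith
    -- An L² bound controls the bias through d ≤ d²/(2u) + u/2.
    have hbias : ∫ z, runMin (r p) J z ∂ρ ≤ (∫ z, g p z ∂ρ) + u J := by
      have huJ := hu J le_rfl
      have h4 : ∀ z, runMin (r p) J z ≤ g p z + ((2 * u J)⁻¹ * (r p J z - g p z) ^ 2 + u J / 2) := by
        intro z
        have h5 := runMin_le (r p) J z
        have h6 : r p J z - g p z ≤ (2 * u J)⁻¹ * (r p J z - g p z) ^ 2 + u J / 2 := by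
          have : 0 ≤ (2 * u J)⁻¹ * (r p J z - g p z - u J) ^ 2 := by positivity
          have h7 : (2 * u J)⁻¹ * (r p J z - g p z - u J) ^ 2 =
            (2 * u J)⁻¹ * (r p J z - g p z) ^ 2 + u J / 2 - (r p J z - g p z) := by
              field_simp; ring
          linarith
        linarith
      have hI : Integrable (fun z => (2 * u J)⁻¹ * (r p J z - g p z) ^ 2 + u J / 2) ρ :=
        ((hsq p J le_rfl).const_mul (2 * u J)⁻¹).add (integrable_const (u J / 2))
      have hI' : Integrable (fun z => g p z + ((2 * u J)⁻¹ * (r p J z - g p z) ^ 2 + u J / 2)) ρ :=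
        (hg p).add hI
      have h8 := integral_mono (hVi p J le_rfl) hI' h4
      have h9 : ∫ z, (g p z + ((2 * u J)⁻¹ * (r p J z - g p z) ^ 2 + u J / 2)) ∂ρ =
          (∫ z, g p z ∂ρ) + ((2 * u J)⁻¹ * (∫ z, (r p J z - g p z) ^ 2 ∂ρ) + u J / 2) := by
        rw [integral_add (hg p) hI, integral_add ((hsq p J le_rfl).const_mul _)
          (integrable_const _), integral_const_mul]
        simp
      have h10 : (2 * u J)⁻¹ * (∫ z, (r p J z - g p z) ^ 2 ∂ρ) ≤ u J / 2 := by
        calc _ ≤ (2 * u J)⁻¹ * u J ^ 2 := by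
              have := hsqle p J le_rfl
              gcongr
          _ = _ := by field_simp
      linarith
    have hS : ∑ i, g p (Z i ω) ≤ ∑ i, runMin (r p) J (Z i ω) :=
      Finset.sum_le_sum fun i _ => hVg p J le_rfl _
    have hB := mul_le_mul_of_nonneg_left hbias (Nat.cast_nonneg (α := ℝ) n)
    have := htel J le_rfl
    linarith
  refine (measure_mono hsub).trans ((measure_union_le _ _).trans (add_le_add h0 ?_))
  exact (measure_biUnion_finset_le _ _).trans
    (Finset.sum_le_sum fun j hj => h1 j (Finset.mem_range.1 hj))

end Tails

/-! ### Moments of the smoothed log-ratio and of its upper brackets. -/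

section Ratio

variable {S : Type*} [MeasurableSpace S] {P : Measure S} {τ : ℝ}
  {ρ r : S → ℝ}

theorem integrable_of_abs_le {f g : S → ℝ} (hg : Integrable g P) (hf : Measurable f)
    (h : ∀ z, |f z| ≤ g z) : Integrable f P :=
  hg.mono' hf.aestronglyMeasurable (Filter.Eventually.of_forall h)

/-- `r` is an upper bracket of `ρ`, with a lower bracket within Hellinger distance `ε`. -/
structure IsUpperBracket (P : Measure S) (ε : ℝ) (ρ r : S → ℝ) : Prop where
  measurable : Measurable r
  le : ∀ z, ρ z ≤ r z
  lower : ∃ l : S → ℝ, Measurable l ∧ (∀ z, 0 ≤ l z) ∧ (∀ z, l z ≤ ρ z) ∧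
    Integrable (fun z => (√(r z) - √(l z)) ^ 2) P ∧ ∫ z, (√(r z) - √(l z)) ^ 2 ∂P ≤ 2 * ε ^ 2

theorem IsUpperBracket.nonneg {ε : ℝ} (h : IsUpperBracket P ε ρ r) (hρ0 : ∀ z, 0 ≤ ρ z) (z : S) : 0 ≤ r z :=
  (hρ0 z).trans (h.le z)

theorem IsUpperBracket.integrable_sq {ε : ℝ} (h : IsUpperBracket P ε ρ r) (hρ : Measurable ρ) :
    Integrable (fun z => (√(r z) - √(ρ z)) ^ 2) P ∧ ∫ z, (√(r z) - √(ρ z)) ^ 2 ∂P ≤ 2 * ε ^ 2 := by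
  obtain ⟨l, hl, hl0, hlρ, hi, hle⟩ := h.lower
  have hp : ∀ z, (√(r z) - √(ρ z)) ^ 2 ≤ (√(r z) - √(l z)) ^ 2 := fun z => by
    have h1 := Real.sqrt_le_sqrt (hlρ z)
    have h2 := Real.sqrt_le_sqrt (h.le z)
    exact pow_le_pow_left₀ (by linarith) (by linarith) 2
  have hI : Integrable (fun z => (√(r z) - √(ρ z)) ^ 2) P :=
    integrable_of_abs_le hi ((h.measurable.sqrt.sub hρ.sqrt).pow_const 2) fun z => by
      rw [abs_of_nonneg (sq_nonneg _)]; exact hp z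
  exact ⟨hI, (integral_mono hI hi hp).trans hle⟩

theorem measurable_mixRatio (hr : Measurable r) : Measurable fun z => mixRatio τ (r z) :=
  (hr.const_mul _).const_add _

theorem measurable_logMix (hr : Measurable r) : Measurable fun z => logMix τ (r z) :=
  Real.measurable_log.comp (measurable_mixRatio hr)

theorem IsUpperBracket.integrable {ε : ℝ} (h : IsUpperBracket P ε ρ r) (hρ : Measurable ρ) (hρ0 : ∀ z, 0 ≤ ρ z)
    (hi : Integrable ρ P) : Integrable r P := by
  refine integrable_of_abs_le (((h.integrable_sq hρ).1.add hi).const_mul 2) h.measurable fun z => ?_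
  have h1 := h.nonneg hρ0 z
  rw [abs_of_nonneg h1]
  simp only [Pi.add_apply]
  nlinarith [Real.sq_sqrt (hρ0 z), Real.sq_sqrt h1, sq_nonneg (√(r z) - 2 * √(ρ z))]

/-- The source of the scale u/(2√2 e^{τ/2}) in the entropy integral: Hellinger brackets of that size
are L² brackets of size u for the smoothed log-ratio. -/
theorem IsUpperBracket.sq_logMix_sub {ε : ℝ} (h : IsUpperBracket P ε ρ r) (hτ : 0 < τ) (hρ : Measurable ρ)
    (hρ0 : ∀ z, 0 ≤ ρ z) :
    Integrable (fun z => (logMix τ (r z) - logMix τ (ρ z)) ^ 2) P ∧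
      ∫ z, (logMix τ (r z) - logMix τ (ρ z)) ^ 2 ∂P ≤
        (2 * √2 * Real.exp (τ / 2) * ε) ^ 2 := by
  obtain ⟨he0, he1⟩ := exp_neg_mem hτ
  obtain ⟨hi, hle⟩ := h.integrable_sq hρ
  have hp : ∀ z, (logMix τ (r z) - logMix τ (ρ z)) ^ 2 ≤
      (2 * Real.exp (τ / 2)) ^ 2 * (√(r z) - √(ρ z)) ^ 2 := by
    intro z
    have h1 := logMix_sub_le hτ (hρ0 z) (h.le z)
    have h2 := logMix_mono hτ (hρ0 z) (h.le z)
    have h3 : √(1 - Real.exp (-τ)) ≤ 1 := Real.sqrt_le_one.2 (by linarith)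
    have h4 : 0 ≤ √(r z) - √(ρ z) := sub_nonneg.2 (Real.sqrt_le_sqrt (h.le z))
    rw [← mul_pow]
    refine pow_le_pow_left₀ (by linarith) (h1.trans ?_) 2
    refine mul_le_mul_of_nonneg_right ?_ h4
    exact mul_le_of_le_one_right (by positivity) h3
  have hI := integrable_of_abs_le (hi.const_mul ((2 * Real.exp (τ / 2)) ^ 2))
    (((measurable_logMix (τ := τ) h.measurable).sub (measurable_logMix hρ)).pow_const 2) fun z => by
      rw [abs_of_nonneg (sq_nonneg _)]; exact hp z
  refine ⟨hI, (integral_mono hI (hi.const_mul _) hp).trans ?_⟩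
  rw [integral_const_mul]
  calc _ ≤ (2 * Real.exp (τ / 2)) ^ 2 * (2 * ε ^ 2) := by gcongr
    _ = 4 * Real.exp (τ / 2) ^ 2 * √2 ^ 2 * ε ^ 2 := by rw [Real.sq_sqrt zero_le_two]; ring
    _ = _ := by ring

variable [IsProbabilityMeasure P]

theorem integrable_mixRatio (hi : Integrable r P) : Integrable (fun z => mixRatio τ (r z)) P :=
  (integrable_const _).add (hi.const_mul _)

theorem integrable_logMix (hτ : 0 < τ) (hr : Measurable r) (hr0 : ∀ z, 0 ≤ r z)
    (hi : Integrable r P) : Integrable (fun z => logMix τ (r z)) P := by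
  refine integrable_of_abs_le ((integrable_const τ).add (integrable_mixRatio (τ := τ) hi))
    (measurable_logMix hr) fun z => ?_
  have h1 := neg_le_logMix hτ (hr0 z)
  have h2 : logMix τ (r z) ≤ mixRatio τ (r z) - 1 :=
    Real.log_le_sub_one_of_pos (mixRatio_pos hτ (hr0 z))
  have h3 := mixRatio_pos hτ (hr0 z)
  simp only [Pi.add_apply]
  rw [abs_le]
  constructor <;> linarith

theorem integrable_sqrt (hr : Measurable r) (hr0 : ∀ z, 0 ≤ r z)
    (hi : Integrable r P) : Integrable (fun z => √(r z)) P := by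
  refine integrable_of_abs_le ((integrable_const 1).add hi) hr.sqrt fun z => ?_
  rw [abs_of_nonneg (Real.sqrt_nonneg _)]
  simp only [Pi.add_apply]
  nlinarith [Real.sq_sqrt (hr0 z), sq_nonneg (√(r z) - 1), Real.sqrt_nonneg (r z)]

theorem integrable_sq_sqrt_sub_one (hr : Measurable r) (hr0 : ∀ z, 0 ≤ r z)
    (hi : Integrable r P) : Integrable (fun z => (√(r z) - 1) ^ 2) P := by
  refine integrable_of_abs_le (((integrable_const 1).add hi).const_mul 2)
    ((hr.sqrt.sub_const 1).pow_const 2) fun z => ?_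
  rw [abs_of_nonneg (sq_nonneg _)]
  simp only [Pi.add_apply]
  nlinarith [Real.sq_sqrt (hr0 z), sq_nonneg (√(r z) + 1)]

theorem integral_sq_sqrt_sub_one (hr : Measurable r) (hr0 : ∀ z, 0 ≤ r z)
    (hi : Integrable r P) :
    ∫ z, (√(r z) - 1) ^ 2 ∂P = (∫ z, r z ∂P) + 1 - 2 * ∫ z, √(r z) ∂P := by
  have h1 : ∀ z, (√(r z) - 1) ^ 2 = (r z + 1) - 2 * √(r z) := fun z => by
    rw [sub_sq, Real.sq_sqrt (hr0 z)]; ring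
  have hI : Integrable (fun z => r z + 1) P := hi.add (integrable_const 1)
  simp_rw [h1]
  rw [integral_sub hI ((integrable_sqrt hr hr0 hi).const_mul 2), integral_add hi (integrable_const 1),
    integral_const_mul]
  simp

/-- The mean of the smoothed log-likelihood ratio is at most a negative multiple of the squared
Hellinger distance. -/
theorem integral_logMix_le (hτ : 0 < τ) (hρ : Measurable ρ) (hρ0 : ∀ z, 0 ≤ ρ z)
    (hi : Integrable ρ P) (h1 : ∫ z, ρ z ∂P ≤ 1) :
    ∫ z, logMix τ (ρ z) ∂P ≤ -((1 - Real.exp (-τ)) ^ 2 / 2 * (1 - ∫ z, √(ρ z) ∂P)) := by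
  obtain ⟨he0, he1⟩ := exp_neg_mem hτ
  have hm := measurable_mixRatio (τ := τ) hρ
  have hm0 : ∀ z, 0 ≤ mixRatio τ (ρ z) := fun z => (mixRatio_pos hτ (hρ0 z)).le
  have hmi := integrable_mixRatio (τ := τ) hi
  have hs := integrable_sqrt hm hm0 hmi
  have hI1 : Integrable (fun z => √(mixRatio τ (ρ z)) - 1) P := hs.sub (integrable_const 1)
  have e1 : ∫ z, logMix τ (ρ z) ∂P ≤ 2 * ((∫ z, √(mixRatio τ (ρ z)) ∂P) - 1) := by
    refine (integral_mono (integrable_logMix hτ hρ hρ0 hi) (hI1.const_mul 2)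
      fun z => logMix_le hτ (hρ0 z)).trans (le_of_eq ?_)
    rw [integral_const_mul, integral_sub hs (integrable_const 1)]
    simp
  have e2 := integral_mono ((integrable_sq_sqrt_sub_one hρ hρ0 hi).const_mul _)
    (integrable_sq_sqrt_sub_one hm hm0 hmi) fun z => le_sq_sqrt_mixRatio_sub_one hτ (hρ0 z)
  rw [integral_const_mul, integral_sq_sqrt_sub_one hρ hρ0 hi,
    integral_sq_sqrt_sub_one hm hm0 hmi] at e2
  have e3 : ∫ z, mixRatio τ (ρ z) ∂P = Real.exp (-τ) + (1 - Real.exp (-τ)) * ∫ z, ρ z ∂P := by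
    unfold mixRatio
    rw [integral_add (integrable_const _) (hi.const_mul _), integral_const_mul]
    simp
  rw [e3] at e2
  set m := ∫ z, ρ z ∂P
  set A := ∫ z, √(ρ z) ∂P
  set e := Real.exp (-τ)
  -- The mass m falls below 1 when p charges the set where p₀ vanishes. That loss lowers the mean of
  -- the mixture by (1 - e)(1 - m), which outweighs its effect on the Hellinger term.
  have e4 : (1 - e) ^ 2 / 4 * (1 - m) ≤ (1 - e) * (1 - m) := by
    have : (1 - e) ^ 2 / 4 ≤ 1 - e := by nlinarith
    exact mul_le_mul_of_nonneg_right this (by linarith)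
  nlinarith

namespace IsUpperBracket

variable {ε : ℝ}

theorem sq_sub_exp_half (h : IsUpperBracket P ε ρ r) (hτ : 0 < τ) (hρ : Measurable ρ)
    (hρ0 : ∀ z, 0 ≤ ρ z) (hi : Integrable ρ P) (h1 : ∫ z, ρ z ∂P ≤ 1) :
    Integrable (fun z => (1 - Real.exp (logMix τ (r z) / 2)) ^ 2) P ∧
    ∫ z, (1 - Real.exp (logMix τ (r z) / 2)) ^ 2 ∂P ≤ 4 * (ε ^ 2 + (1 - ∫ z, √(ρ z) ∂P)) := by
  obtain ⟨he0, he1⟩ := exp_neg_mem hτ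
  obtain ⟨hi2, hle2⟩ := h.integrable_sq hρ
  have hr0 := h.nonneg hρ0
  have hρ2 := integrable_sq_sqrt_sub_one hρ hρ0 hi
  have hI : Integrable (fun z => 2 * ((√(r z) - √(ρ z)) ^ 2 + (√(ρ z) - 1) ^ 2)) P :=
    (hi2.add hρ2).const_mul 2
  have hp : ∀ z, (1 - Real.exp (logMix τ (r z) / 2)) ^ 2 ≤
      2 * ((√(r z) - √(ρ z)) ^ 2 + (√(ρ z) - 1) ^ 2) := by
    intro z
    rw [exp_half_logMix hτ (hr0 z)]
    have h2 := sq_sqrt_mixRatio_sub_le hτ (hρ0 z) (hr0 z)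
    have h3 := sq_sqrt_mixRatio_sub_one_le hτ (hρ0 z)
    have h4 : (1 - Real.exp (-τ)) * (√(r z) - √(ρ z)) ^ 2 ≤ (√(r z) - √(ρ z)) ^ 2 :=
      mul_le_of_le_one_left (sq_nonneg _) (by linarith)
    have h5 : (1 - Real.exp (-τ)) * (√(ρ z) - 1) ^ 2 ≤ (√(ρ z) - 1) ^ 2 :=
      mul_le_of_le_one_left (sq_nonneg _) (by linarith)
    nlinarith [sq_nonneg ((√(mixRatio τ (r z)) - √(mixRatio τ (ρ z))) - (√(mixRatio τ (ρ z)) - 1))]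
  have hJ : Integrable (fun z => (1 - Real.exp (logMix τ (r z) / 2)) ^ 2) P := by
    refine integrable_of_abs_le hI ?_ fun z => by rw [abs_of_nonneg (sq_nonneg _)]; exact hp z
    exact ((Real.measurable_exp.comp ((measurable_logMix h.measurable).div_const 2)).const_sub
      1).pow_const 2
  refine ⟨hJ, (integral_mono hJ hI hp).trans ?_⟩
  rw [integral_const_mul, integral_add hi2 hρ2, integral_sq_sqrt_sub_one hρ hρ0 hi]
  linarith

theorem integral_exp_le (h : IsUpperBracket P ε ρ r) (hτ : 0 < τ) (hρ : Measurable ρ)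
    (hρ0 : ∀ z, 0 ≤ ρ z) (hi : Integrable ρ P) (h1 : ∫ z, ρ z ∂P ≤ 1) {t : ℝ} (ht0 : 0 ≤ t)
    (ht : t ≤ 1 / 2) :
    Integrable (fun z => Real.exp (t * logMix τ (r z))) P ∧
    ∫ z, Real.exp (t * logMix τ (r z)) ∂P ≤ Real.exp (t * ((∫ z, logMix τ (r z) ∂P) +
      2 * t * kappa τ * ∫ z, (1 - Real.exp (logMix τ (r z) / 2)) ^ 2 ∂P)) := by
  have hr0 := h.nonneg hρ0
  have hU := integrable_logMix hτ h.measurable hr0 (h.integrable hρ hρ0 hi)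
  have hd := (h.sq_sub_exp_half hτ hρ hρ0 hi h1).1
  have hI0 : Integrable (fun z => 1 + t * logMix τ (r z)) P :=
    (integrable_const 1).add (hU.const_mul t)
  have hI : Integrable (fun z => 1 + t * logMix τ (r z) +
      2 * t ^ 2 * kappa τ * (1 - Real.exp (logMix τ (r z) / 2)) ^ 2) P :=
    hI0.add (hd.const_mul _)
  have hp := fun z => exp_mul_le_of_neg_le hτ (neg_le_logMix hτ (hr0 z)) ht0 ht
  have hJ : Integrable (fun z => Real.exp (t * logMix τ (r z))) P :=
    integrable_of_abs_le hI (Real.measurable_exp.comp ((measurable_logMix h.measurable).const_mul t))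
      fun z => by rw [Real.abs_exp]; exact hp z
  refine ⟨hJ, (integral_mono hJ hI hp).trans ?_⟩
  rw [integral_add hI0 (hd.const_mul _), integral_add (integrable_const 1) (hU.const_mul t),
    integral_const_mul, integral_const_mul]
  simp only [integral_const, probReal_univ, smul_eq_mul, mul_one]
  refine le_trans (le_of_eq ?_) (Real.add_one_le_exp _)
  ring

end IsUpperBracket

end Ratio

/-! ### Ratios of densities under the joint law, and Hellinger distances. -/

section Density

variable {X Y : Type*} [MeasurableSpace X] [MeasurableSpace Y] {Q : Measure X} {ν : Measure Y}
  {p₀ p : X → Y → ℝ}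

/-- The ratio of `b` to the density `p₀`. -/
noncomputable def ratio (p₀ b : X → Y → ℝ) (z : X × Y) : ℝ := b z.1 z.2 / p₀ z.1 z.2

theorem measurable_ratio {b : X → Y → ℝ} (h₀ : IsCondDensity ν p₀)
    (hb : Measurable (Function.uncurry b)) : Measurable (ratio p₀ b) :=
  hb.div h₀.measurable

theorem ratio_nonneg {b : X → Y → ℝ} (h₀ : IsCondDensity ν p₀) (hb : ∀ x y, 0 ≤ b x y)
    (z : X × Y) : 0 ≤ ratio p₀ b z :=
  div_nonneg (hb _ _) (h₀.nonneg _ _)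

theorem ratio_mono {b c : X → Y → ℝ} (h₀ : IsCondDensity ν p₀) (h : ∀ x y, b x y ≤ c x y)
    (z : X × Y) : ratio p₀ b z ≤ ratio p₀ c z :=
  div_le_div_of_nonneg_right (h _ _) (h₀.nonneg _ _)

theorem ae_jointLaw_pos (h₀ : IsCondDensity ν p₀) :
    ∀ᵐ z ∂jointLaw Q ν p₀, 0 < p₀ z.1 z.2 := by
  have hm : Measurable fun z : X × Y => ENNReal.ofReal (p₀ z.1 z.2) :=
    h₀.measurable.ennreal_ofReal
  rw [jointLaw, ae_withDensity_iff hm]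
  refine Filter.Eventually.of_forall fun z hz => ?_
  simpa using hz

variable [SigmaFinite ν]

theorem lintegral_jointLaw (h₀ : IsCondDensity ν p₀) {f : X × Y → ℝ≥0∞} (hf : Measurable f) :
    ∫⁻ z, f z ∂jointLaw Q ν p₀ = ∫⁻ x, ∫⁻ y, ENNReal.ofReal (p₀ x y) * f (x, y) ∂ν ∂Q := by
  have hm : Measurable fun z : X × Y => ENNReal.ofReal (p₀ z.1 z.2) :=
    h₀.measurable.ennreal_ofReal
  rw [jointLaw, lintegral_withDensity_eq_lintegral_mul _ hm hf,
    lintegral_prod _ (hm.mul hf).aemeasurable]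
  rfl

theorem isProbabilityMeasure_jointLaw [IsProbabilityMeasure Q] (h₀ : IsCondDensity ν p₀) :
    IsProbabilityMeasure (jointLaw Q ν p₀) := by
  constructor
  rw [← lintegral_one, lintegral_jointLaw h₀ measurable_const]
  simp [h₀.lintegral_eq_one]

/-- Only an inequality: mass of p on {p₀ = 0} is not seen by the joint law, and the ratio is 0 there
by the convention for division. -/
theorem lintegral_ratio_le [IsProbabilityMeasure Q] (h₀ : IsCondDensity ν p₀)
    (hp : IsCondDensity ν p) : ∫⁻ z, ENNReal.ofReal (ratio p₀ p z) ∂jointLaw Q ν p₀ ≤ 1 := by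
  rw [lintegral_jointLaw h₀ (measurable_ratio h₀ hp.measurable).ennreal_ofReal]
  calc _ ≤ ∫⁻ x, ∫⁻ y, ENNReal.ofReal (p x y) ∂ν ∂Q := by
        refine lintegral_mono fun x => lintegral_mono fun y => ?_
        rw [← ENNReal.ofReal_mul (h₀.nonneg _ _)]
        refine ENNReal.ofReal_le_ofReal ?_
        rcases (h₀.nonneg x y).eq_or_lt with h | h
        · simp [← h, hp.nonneg]
        · simp only [ratio]; rw [mul_div_cancel₀ _ h.ne']
    _ = 1 := by simp [hp.lintegral_eq_one]

theorem lintegral_sq_sqrt_ratio_sub_le {b c : X → Y → ℝ} (h₀ : IsCondDensity ν p₀)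
    (hb : Measurable (Function.uncurry b)) (hc : Measurable (Function.uncurry c))
    (hb0 : ∀ x y, 0 ≤ b x y) (hc0 : ∀ x y, 0 ≤ c x y) :
    ∫⁻ z, ENNReal.ofReal ((√(ratio p₀ c z) - √(ratio p₀ b z)) ^ 2) ∂jointLaw Q ν p₀ ≤
      2 * hellingerSq Q ν b c := by
  have hmr : Measurable fun z => ENNReal.ofReal ((√(ratio p₀ c z) - √(ratio p₀ b z)) ^ 2) :=
    (((measurable_ratio h₀ hc).sqrt.sub (measurable_ratio h₀ hb).sqrt).pow_const 2).ennreal_ofReal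
  rw [lintegral_jointLaw h₀ hmr, hellingerSq]
  unfold hellingerSqAt
  have hm : Measurable fun z : X × Y => ENNReal.ofReal ((√(b z.1 z.2) - √(c z.1 z.2)) ^ 2) :=
    ((hb.sqrt.sub hc.sqrt).pow_const 2).ennreal_ofReal
  rw [lintegral_const_mul _ hm.lintegral_prod_right', ← mul_assoc,
    ENNReal.mul_inv_cancel two_ne_zero ENNReal.ofNat_ne_top, one_mul]
  refine lintegral_mono fun x => lintegral_mono fun y => ?_
  rw [← ENNReal.ofReal_mul (h₀.nonneg _ _)]
  refine ENNReal.ofReal_le_ofReal ?_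
  simp only [ratio]
  rcases (h₀.nonneg x y).eq_or_lt with h | h
  · rw [← h]; simpa using sq_nonneg _
  · rw [Real.sqrt_div (hb0 _ _), Real.sqrt_div (hc0 _ _), ← sub_div, div_pow, Real.sq_sqrt h.le,
      mul_div_cancel₀ _ h.ne']
    exact le_of_eq (by ring)

/-- The expansion of the square: p₀√(p/p₀) = √(p p₀), also where p₀ = 0. The additive form avoids
truncated subtraction. -/
theorem hellingerSq_add_lintegral_sqrt_ratio [IsProbabilityMeasure Q] (h₀ : IsCondDensity ν p₀)
    (hp : IsCondDensity ν p) :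
    hellingerSq Q ν p p₀ + ∫⁻ z, ENNReal.ofReal (√(ratio p₀ p z)) ∂jointLaw Q ν p₀ = 1 := by
  have hmr := measurable_ratio h₀ hp.measurable
  have hpm := hp.measurable
  have h₀m := h₀.measurable
  have hm : Measurable fun z : X × Y => ENNReal.ofReal ((√(p z.1 z.2) - √(p₀ z.1 z.2)) ^ 2) :=
    ((hpm.sqrt.sub h₀m.sqrt).pow_const 2).ennreal_ofReal
  have hm2 : Measurable fun z : X × Y => ENNReal.ofReal (p₀ z.1 z.2) *
      ENNReal.ofReal (√(ratio p₀ p z)) := h₀m.ennreal_ofReal.mul hmr.sqrt.ennreal_ofReal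
  have hp1 : Measurable fun z : X × Y => ENNReal.ofReal (p z.1 z.2) := hpm.ennreal_ofReal
  have hin : ∀ x, ∀ f : X × Y → ℝ≥0∞, Measurable f → Measurable fun y => f (x, y) :=
    fun x f hf => hf.comp measurable_prodMk_left
  rw [lintegral_jointLaw h₀ hmr.sqrt.ennreal_ofReal, hellingerSq]
  unfold hellingerSqAt
  rw [← lintegral_add_left (hm.lintegral_prod_right'.const_mul _)]
  have hx : ∀ x, 2⁻¹ * ∫⁻ y, ENNReal.ofReal ((√(p x y) - √(p₀ x y)) ^ 2) ∂ν +
      ∫⁻ y, ENNReal.ofReal (p₀ x y) * ENNReal.ofReal (√(ratio p₀ p (x, y))) ∂ν = 1 := by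
    intro x
    have hpt : ∀ y, ENNReal.ofReal ((√(p x y) - √(p₀ x y)) ^ 2) +
        2 * (ENNReal.ofReal (p₀ x y) * ENNReal.ofReal (√(ratio p₀ p (x, y)))) =
        ENNReal.ofReal (p x y) + ENNReal.ofReal (p₀ x y) := by
      intro y
      have h2 : (2 : ℝ≥0∞) = ENNReal.ofReal 2 := by simp
      rw [← ENNReal.ofReal_mul (h₀.nonneg _ _), h2, ← ENNReal.ofReal_mul zero_le_two,
        ← ENNReal.ofReal_add (sq_nonneg _)
          (by have := h₀.nonneg x y; positivity),
        ← ENNReal.ofReal_add (hp.nonneg _ _) (h₀.nonneg _ _)]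
      congr 1
      have e1 : p₀ x y * √(ratio p₀ p (x, y)) = √(p x y) * √(p₀ x y) := by
        simp only [ratio]
        rw [Real.sqrt_div (hp.nonneg _ _)]
        rcases (h₀.nonneg x y).eq_or_lt with h | h
        · simp [← h]
        · have : 0 < √(p₀ x y) := Real.sqrt_pos.2 h
          field_simp
          rw [Real.sq_sqrt h.le]
          ring
      rw [e1, sub_sq, Real.sq_sqrt (hp.nonneg _ _), Real.sq_sqrt (h₀.nonneg _ _)]
      ring
    have hsum := lintegral_congr (μ := ν) hpt
    rw [lintegral_add_left (hin x _ hm), lintegral_const_mul _ (hin x _ hm2),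
      lintegral_add_left (hin x _ hp1), hp.lintegral_eq_one,
      h₀.lintegral_eq_one] at hsum
    have h3 := congrArg (fun a => 2⁻¹ * a) hsum
    simp only [mul_add, ← mul_assoc, ENNReal.inv_mul_cancel two_ne_zero ENNReal.ofNat_ne_top,
      one_mul, mul_one, ENNReal.inv_two_add_inv_two] at h3
    exact h3
  rw [lintegral_congr hx]
  simp

theorem isUpperBracket_ratio {b c : X → Y → ℝ} {ε : ℝ} (h₀ : IsCondDensity ν p₀)
    (hb : Measurable (Function.uncurry b)) (hc : Measurable (Function.uncurry c))
    (hb0 : ∀ x y, 0 ≤ b x y) (hbp : ∀ x y, b x y ≤ p x y) (hpc : ∀ x y, p x y ≤ c x y)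
    (hε : 0 ≤ ε) (hH : hellinger Q ν b c ≤ ENNReal.ofReal ε) :
    IsUpperBracket (jointLaw Q ν p₀) ε (ratio p₀ p) (ratio p₀ c) := by
  have hmb := measurable_ratio h₀ hb
  have hmc := measurable_ratio h₀ hc
  refine ⟨hmc, ratio_mono h₀ hpc, ratio p₀ b, hmb, ratio_nonneg h₀ hb0, ratio_mono h₀ hbp, ?_⟩
  have hsq : hellingerSq Q ν b c ≤ ENNReal.ofReal (ε ^ 2) := by
    have h1 : hellingerSq Q ν b c = hellinger Q ν b c ^ (2 : ℝ) := by
      rw [hellinger, ← ENNReal.rpow_mul]; norm_num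
    rw [h1, ENNReal.ofReal_pow hε, ← ENNReal.rpow_natCast]
    exact ENNReal.rpow_le_rpow hH (by norm_num)
  have h0 : ∀ z, 0 ≤ (√(ratio p₀ c z) - √(ratio p₀ b z)) ^ 2 := fun z => sq_nonneg _
  have hm : Measurable fun z => (√(ratio p₀ c z) - √(ratio p₀ b z)) ^ 2 :=
    (hmc.sqrt.sub hmb.sqrt).pow_const 2
  have hle : ∫⁻ z, ENNReal.ofReal ((√(ratio p₀ c z) - √(ratio p₀ b z)) ^ 2) ∂jointLaw Q ν p₀ ≤
      ENNReal.ofReal (2 * ε ^ 2) := by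
    refine (lintegral_sq_sqrt_ratio_sub_le h₀ hb hc hb0
      fun x y => (hb0 x y).trans ((hbp x y).trans (hpc x y))).trans ?_
    rw [ENNReal.ofReal_mul zero_le_two, ENNReal.ofReal_ofNat]
    gcongr
  refine ⟨⟨hm.aestronglyMeasurable, ?_⟩, ?_⟩
  · rw [hasFiniteIntegral_iff_ofReal (Filter.Eventually.of_forall h0)]
    exact hle.trans_lt ENNReal.ofReal_lt_top
  · rw [integral_eq_lintegral_of_nonneg_ae (Filter.Eventually.of_forall h0) hm.aestronglyMeasurable]
    exact ENNReal.toReal_le_of_le_ofReal (by positivity) hle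

variable [IsProbabilityMeasure Q]

theorem integrable_ratio (h₀ : IsCondDensity ν p₀) (hp : IsCondDensity ν p) :
    Integrable (ratio p₀ p) (jointLaw Q ν p₀) ∧ ∫ z, ratio p₀ p z ∂jointLaw Q ν p₀ ≤ 1 := by
  have hm := measurable_ratio h₀ hp.measurable
  have h0 : 0 ≤ᵐ[jointLaw Q ν p₀] ratio p₀ p :=
    Filter.Eventually.of_forall (ratio_nonneg h₀ hp.nonneg)
  have hle := lintegral_ratio_le (Q := Q) h₀ hp
  refine ⟨⟨hm.aestronglyMeasurable, ?_⟩, ?_⟩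
  · rw [hasFiniteIntegral_iff_ofReal h0]
    exact hle.trans_lt ENNReal.one_lt_top
  · rw [integral_eq_lintegral_of_nonneg_ae h0 hm.aestronglyMeasurable]
    exact ENNReal.toReal_le_of_le_ofReal zero_le_one (by simpa using hle)

theorem hellingerSq_eq (h₀ : IsCondDensity ν p₀) (hp : IsCondDensity ν p) :
    hellingerSq Q ν p p₀ = ENNReal.ofReal (1 - ∫ z, √(ratio p₀ p z) ∂jointLaw Q ν p₀) ∧
      0 ≤ 1 - ∫ z, √(ratio p₀ p z) ∂jointLaw Q ν p₀ := by
  have := isProbabilityMeasure_jointLaw (Q := Q) h₀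
  have hm := measurable_ratio h₀ hp.measurable
  have h := hellingerSq_add_lintegral_sqrt_ratio (Q := Q) h₀ hp
  have hs := integrable_sqrt hm (ratio_nonneg h₀ hp.nonneg) (integrable_ratio (Q := Q) h₀ hp).1
  rw [← ofReal_integral_eq_lintegral_ofReal hs
    (Filter.Eventually.of_forall fun z => Real.sqrt_nonneg _)] at h
  have hA : 0 ≤ ∫ z, √(ratio p₀ p z) ∂jointLaw Q ν p₀ :=
    integral_nonneg fun z => Real.sqrt_nonneg _
  constructor
  · rw [ENNReal.ofReal_sub _ hA, ENNReal.ofReal_one, ← h,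
      ENNReal.add_sub_cancel_right ENNReal.ofReal_ne_top]
  · have : ENNReal.ofReal (∫ z, √(ratio p₀ p z) ∂jointLaw Q ν p₀) ≤ 1 := h ▸ le_add_self
    rw [ENNReal.ofReal_le_one] at this
    linarith

end Density

/-! ### The entropy integral and the dyadic levels. -/

/-- A dyadic lower Riemann sum of an antitone function. -/
theorem sum_dyadic_le_lintegral {h : ℝ → ℝ≥0∞} (hh : Antitone h) {u : ℝ} (hu : 0 < u) (J : ℕ) :
    ∑ j ∈ Finset.range (J + 1), ENNReal.ofReal (u / 2 ^ (j + 1)) * h (u / 2 ^ j) ≤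
      ∫⁻ x in Set.Ioc (u / 2 ^ (J + 1)) u, h x := by
  have hstep : ∀ j : ℕ, ENNReal.ofReal (u / 2 ^ (j + 1)) * h (u / 2 ^ j) ≤
      ∫⁻ x in Set.Ioc (u / 2 ^ (j + 1)) (u / 2 ^ j), h x := by
    intro j
    have hc : ∫⁻ _ in Set.Ioc (u / 2 ^ (j + 1)) (u / 2 ^ j), h (u / 2 ^ j) =
        ENNReal.ofReal (u / 2 ^ (j + 1)) * h (u / 2 ^ j) := by
      rw [setLIntegral_const, Real.volume_Ioc, mul_comm]
      congr 2
      rw [pow_succ]; field_simp; norm_num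
    rw [← hc]
    refine lintegral_mono_ae ((ae_restrict_iff' measurableSet_Ioc).2
      (Filter.Eventually.of_forall fun x hx => hh hx.2))
  induction J with
  | zero => simpa using hstep 0
  | succ J ih =>
    rw [Finset.sum_range_succ]
    have h1 : u / 2 ^ (J + 1 + 1) ≤ u / 2 ^ (J + 1) := by
      gcongr
      · norm_num
      · omega
    have h2 : u / 2 ^ (J + 1) ≤ u := div_le_self hu.le (one_le_pow₀ one_le_two)
    rw [← Set.Ioc_union_Ioc_eq_Ioc h1 h2, lintegral_union measurableSet_Ioc
      (Set.Ioc_disjoint_Ioc_of_le le_rfl), add_comm]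
    exact add_le_add (hstep (J + 1)) ih

section Entropy

variable {X Y : Type*} [MeasurableSpace X] [MeasurableSpace Y] {Q : Measure X} {ν : Measure Y}
  {P : Set (X → Y → ℝ)}

theorem bracketingNumber_antitone : Antitone fun ε => bracketingNumber Q ν ε P := by
  intro ε ε' h
  refine le_iInf₂ fun B hB => iInf₂_le_of_le B ⟨hB.measurable, hB.nonneg, fun p hp => ?_⟩ le_rfl
  obtain ⟨b₁, h₁, b₂, h₂, hH, hb⟩ := hB.cover p hp
  exact ⟨b₁, h₁, b₂, h₂, hH.trans (ENNReal.ofReal_le_ofReal h), hb⟩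

theorem bracketingEntropy_antitone : Antitone fun ε => bracketingEntropy Q ν ε P := by
  intro ε ε' h
  exact EReal.toENNReal_le_toENNReal (ENNReal.log_monotone
    (ENat.toENNReal_le.2 (bracketingNumber_antitone h)))

theorem exists_finite_cover {ε : ℝ} (h : bracketingEntropy Q ν ε P ≠ ⊤) :
    ∃ B : Finset (X → Y → ℝ), IsBracketCover Q ν ε P B ∧
      ENNReal.ofReal (Real.log B.card) ≤ bracketingEntropy Q ν ε P := by
  have hN : bracketingNumber Q ν ε P ≠ ⊤ := by
    intro hN
    refine h ?_
    rw [bracketingEntropy, hN]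
    simp
  obtain ⟨N, hN'⟩ := ENat.ne_top_iff_exists.1 hN
  have hlt : bracketingNumber Q ν ε P < (N + 1 : ℕ) := by
    rw [← hN']; exact_mod_cast Nat.lt_succ_self N
  obtain ⟨B, hB, hBN⟩ : ∃ B, ∃ _ : IsBracketCover Q ν ε P B, B.encard < (N + 1 : ℕ) := by
    simpa [bracketingNumber, iInf_lt_iff] using hlt
  have hfin : B.Finite := Set.finite_of_encard_le_coe hBN.le
  refine ⟨hfin.toFinset, by simpa using hB, ?_⟩
  have hcard : hfin.toFinset.card ≤ N := by
    rw [hfin.encard_eq_coe_toFinset_card] at hBN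
    exact Nat.lt_succ_iff.1 (by exact_mod_cast hBN)
  rcases Nat.eq_zero_or_pos hfin.toFinset.card with h0 | h0
  · simp [h0]
  have hNpos : 0 < N := h0.trans_le hcard
  rw [bracketingEntropy, ← hN', ENat.toENNReal_coe, ENNReal.log_pos_real (by simpa using hNpos.ne')
    (ENNReal.natCast_ne_top N), EReal.toENNReal_of_ne_top (EReal.coe_ne_top _), EReal.toReal_coe,
    ENNReal.toReal_natCast]
  exact ENNReal.ofReal_le_ofReal (Real.log_le_log (by exact_mod_cast h0) (by exact_mod_cast hcard))

/-- The dyadic levels of the chain, with covers whose entropies are controlled by the entropy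
integral. -/
theorem exists_levels {σ τ C : ℝ} (hσ : 0 < σ) (hσ9 : σ ≤ 2 ^ 9) (hC : 0 ≤ C)
    (hint : (∫⁻ u in Set.Ioc (σ ^ 2 / 2 ^ 10) σ,
      bracketingEntropy Q ν (u / (2 * √2 * Real.exp (τ / 2))) P ^ (1 / 2 : ℝ)) ≤
        ENNReal.ofReal C) :
    ∃ (J : ℕ) (u : ℝ) (B : ℕ → Finset (X → Y → ℝ)),
      u / 2 ^ J = σ ^ 2 / 2 ^ 9 ∧ u ≤ σ ∧ σ / 16 ≤ u ∧ (J = 0 ∨ u ≤ σ / 8) ∧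
      (∀ j ≤ J, IsBracketCover Q ν (u / 2 ^ j / (2 * √2 * Real.exp (τ / 2))) P (B j)) ∧
      ∑ j ∈ Finset.range (J + 1), u / 2 ^ j * √(Real.log (B j).card) ≤ 2 * C := by
  obtain ⟨J, u, h1, h2, h3, h4⟩ : ∃ (J : ℕ) (u : ℝ), u / 2 ^ J = σ ^ 2 / 2 ^ 9 ∧ u ≤ σ ∧
      σ / 16 ≤ u ∧ (J = 0 ∨ u ≤ σ / 8) := by
    -- The finest scale must be σ²/2⁹, twice the lower limit of the integral. With J maximal such
    -- that 2^J σ ≤ 64, the coarsest scale 2^J σ²/2⁹ lies between σ/16 and σ/8. For σ > 64 a single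
    -- level is enough, and σ ≤ 2⁹ keeps it below σ.
    rcases le_or_gt σ 64 with h | h
    · obtain ⟨J, hJ1, hJ2⟩ := exists_nat_pow_near (x := 64 / σ) (y := 2)
        (by rw [le_div_iff₀ hσ]; linarith) one_lt_two
      rw [le_div_iff₀ hσ] at hJ1
      rw [div_lt_iff₀ hσ, pow_succ] at hJ2
      have e : (2 : ℝ) ^ J * (σ ^ 2 / 2 ^ 9) = (2 ^ J * σ) * (σ / 2 ^ 9) := by ring
      refine ⟨J, 2 ^ J * (σ ^ 2 / 2 ^ 9), by field_simp, ?_, ?_, Or.inr ?_⟩ <;> rw [e] <;> nlinarith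
    · exact ⟨0, σ ^ 2 / 2 ^ 9, by simp, by nlinarith, by nlinarith, Or.inl rfl⟩
  have hu : 0 < u := by linarith
  set h : ℝ → ℝ≥0∞ := fun u =>
    bracketingEntropy Q ν (u / (2 * √2 * Real.exp (τ / 2))) P ^ (1 / 2 : ℝ) with hh
  have hanti : Antitone h := fun a b hab => ENNReal.rpow_le_rpow
    (bracketingEntropy_antitone (div_le_div_of_nonneg_right hab (by positivity))) (by norm_num)
  have hsum := sum_dyadic_le_lintegral hanti hu J
  have hsum' : ∑ j ∈ Finset.range (J + 1), ENNReal.ofReal (u / 2 ^ (j + 1)) * h (u / 2 ^ j) ≤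
      ENNReal.ofReal C := by
    refine hsum.trans (le_trans (lintegral_mono_set (Set.Ioc_subset_Ioc ?_ h2)) hint)
    rw [pow_succ (2 : ℝ) J, ← div_div, h1]
    exact le_of_eq (by ring)
  -- An infinite entropy at one level would make its positive-length dyadic piece infinite.
  have hfin : ∀ j ≤ J, bracketingEntropy Q ν (u / 2 ^ j / (2 * √2 * Real.exp (τ / 2))) P ≠ ⊤ := by
    intro j hj htop
    have hle := (Finset.single_le_sum (f := fun j => ENNReal.ofReal (u / 2 ^ (j + 1)) *
      h (u / 2 ^ j)) (fun _ _ => zero_le) (Finset.mem_range.2 (Nat.lt_succ_of_le hj))).trans hsum'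
    have : h (u / 2 ^ j) = ⊤ := by
      simp only [hh, htop]
      exact ENNReal.top_rpow_of_pos (by norm_num)
    simp only [this] at hle
    rw [ENNReal.mul_top (by simpa using by positivity), top_le_iff] at hle
    exact ENNReal.ofReal_ne_top hle
  choose! B hB hBle using fun j hj => exists_finite_cover (hfin j hj)
  refine ⟨J, u, B, h1, h2, h3, h4, hB, ?_⟩
  have hreal : ENNReal.ofReal (∑ j ∈ Finset.range (J + 1),
      u / 2 ^ (j + 1) * √(Real.log (B j).card)) ≤ ENNReal.ofReal C := by
    rw [ENNReal.ofReal_sum_of_nonneg fun j _ => by positivity]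
    refine (Finset.sum_le_sum fun j hj => ?_).trans hsum'
    rw [ENNReal.ofReal_mul (by positivity)]
    gcongr
    rw [Real.sqrt_eq_rpow, ← ENNReal.ofReal_rpow_of_nonneg (Real.log_natCast_nonneg _) (by norm_num)]
    exact ENNReal.rpow_le_rpow (hBle j (Nat.lt_succ_iff.1 (Finset.mem_range.1 hj))) (by norm_num)
  rw [ENNReal.ofReal_le_ofReal_iff hC] at hreal
  calc _ = 2 * ∑ j ∈ Finset.range (J + 1), u / 2 ^ (j + 1) * √(Real.log (B j).card) := by
        rw [Finset.mul_sum]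
        refine Finset.sum_congr rfl fun j _ => ?_
        rw [pow_succ]; field_simp
    _ ≤ 2 * C := by gcongr

end Entropy

/-! ### Budget of deviations along the chain. -/

/-- Exchange of summation. The inner sum runs to j + 1 because link j involves brackets of all
levels up to j + 1. -/
theorem sum_dyadic_partial_sums_le {a : ℕ → ℝ} (ha : ∀ i, 0 ≤ a i) (J : ℕ) :
    ∑ j ∈ Finset.range J, (1 / 2 ^ j : ℝ) * ∑ i ∈ Finset.range (j + 2), a i ≤
      4 * ∑ i ∈ Finset.range (J + 1), 1 / 2 ^ i * a i := by
  have key : (∑ j ∈ Finset.range J, (1 / 2 ^ j : ℝ) * ∑ i ∈ Finset.range (j + 2), a i) +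
      2 * (1 / 2 ^ J) * ∑ i ∈ Finset.range (J + 1), a i ≤
      4 * ∑ i ∈ Finset.range (J + 1), 1 / 2 ^ i * a i := by
    induction J with
    | zero => simp; linarith [ha 0]
    | succ J ih =>
      rw [Finset.sum_range_succ, Finset.sum_range_succ (fun i => 1 / 2 ^ i * a i) (J + 1),
        Finset.sum_range_succ a (J + 1)]
      have e : (1 / 2 ^ (J + 1) : ℝ) = 1 / 2 ^ J / 2 := by rw [pow_succ]; field_simp
      rw [e]
      linarith
  have : 0 ≤ 2 * (1 / 2 ^ J : ℝ) * ∑ i ∈ Finset.range (J + 1), a i := by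
    have := Finset.sum_nonneg fun i (_ : i ∈ Finset.range (J + 1)) => ha i
    positivity
  linarith

theorem sum_dyadic_le (J : ℕ) : ∑ j ∈ Finset.range J, (1 / 2 ^ j : ℝ) ≤ 2 := by
  have key : (∑ j ∈ Finset.range J, (1 / 2 ^ j : ℝ)) + 2 * (1 / 2 ^ J) ≤ 2 := by
    induction J with
    | zero => simp
    | succ J ih =>
      rw [Finset.sum_range_succ, pow_succ]
      have e : (1 / (2 ^ J * 2) : ℝ) = 1 / 2 ^ J / 2 := by field_simp
      rw [e]; linarith
  have : (0 : ℝ) < 1 / 2 ^ J := by positivity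
  linarith

theorem sum_dyadic_mul_le (J : ℕ) : ∑ j ∈ Finset.range J, (1 / 2 ^ j : ℝ) * (j + 1) ≤ 4 := by
  have key : (∑ j ∈ Finset.range J, (1 / 2 ^ j : ℝ) * (j + 1)) + (1 / 2 ^ J) * (2 * J + 4) ≤ 4 := by
    induction J with
    | zero => simp
    | succ J ih =>
      rw [Finset.sum_range_succ, pow_succ]
      have e : (1 / (2 ^ J * 2) : ℝ) = 1 / 2 ^ J / 2 := by field_simp
      rw [e]; push_cast; linarith
  have : (0 : ℝ) ≤ 1 / 2 ^ J * (2 * J + 4) := by positivity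
  linarith

theorem sum_exp_neg_le {δ : ℝ} (hδ : 0 < δ) (J : ℕ) :
    ∑ j ∈ Finset.range J, Real.exp (-(δ * (j + 1))) ≤ 1 / δ := by
  set q := Real.exp (-δ) with hq
  have hq0 : 0 < q := Real.exp_pos _
  have hq1 : q < 1 := Real.exp_lt_one_iff.2 (by linarith)
  have e : ∀ j : ℕ, Real.exp (-(δ * (j + 1))) = q * q ^ j := fun j => by
    rw [hq, ← Real.exp_nat_mul, ← Real.exp_add]; congr 1; ring
  simp_rw [e]
  rw [← Finset.mul_sum, geom_sum_eq hq1.ne]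
  have h1 : q * (1 + δ) ≤ 1 := by
    have h2 := Real.add_one_le_exp δ
    calc q * (1 + δ) ≤ q * Real.exp δ := by gcongr; linarith
      _ = 1 := by rw [hq, ← Real.exp_add]; simp
  have h3 : q * ((q ^ J - 1) / (q - 1)) = q * (1 - q ^ J) / (1 - q) := by
    rw [← neg_div_neg_eq, neg_sub, neg_sub, mul_div_assoc]
  rw [h3, div_le_div_iff₀ (by linarith) hδ]
  have h4 : 0 < q ^ J := by positivity
  nlinarith [mul_pos hq0 h4]

/-- The width of the deviation allowed at level `j` of the chain. -/
noncomputable def chainDev (n : ℕ) (σ α u : ℝ) (H : ℕ → ℝ) (j : ℕ) : ℝ :=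
  u / 2 ^ j * (√(2 / n) * ∑ i ∈ Finset.range (j + 2), √(H i) + √(4 * cOne * α) +
    1 / 2 ^ 12 * (j + 1) * σ)

theorem cOne_pos : 0 < cOne := by unfold cOne; norm_num

theorem chainDev_nonneg {n : ℕ} {σ α u : ℝ} {H : ℕ → ℝ} (hσ : 0 ≤ σ) (hu : 0 ≤ u) (j : ℕ) :
    0 ≤ chainDev n σ α u H j := by
  unfold chainDev
  have : 0 ≤ ∑ i ∈ Finset.range (j + 2), √(H i) := Finset.sum_nonneg fun _ _ => Real.sqrt_nonneg _
  positivity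

theorem sum_le_sq_sum_sqrt {H : ℕ → ℝ} (hH : ∀ i, 0 ≤ H i) (k : ℕ) :
    ∑ i ∈ Finset.range k, H i ≤ (∑ i ∈ Finset.range k, √(H i)) ^ 2 := by
  have h := Finset.sum_sq_le_sq_sum_of_nonneg (s := Finset.range k) (f := fun i => √(H i))
    fun _ _ => Real.sqrt_nonneg _
  simpa [Real.sq_sqrt (hH _)] using h

/-- The square of `chainDev` dominates the sum of the squares of its three terms. They pay
respectively for the number of links, for the target exponent 2c₁nα, and for summability over j; the
last uses nσ² ≥ 1. -/
theorem le_mul_sq_chainDev {n : ℕ} {σ α u : ℝ} {H : ℕ → ℝ} (hn : 0 < n) (hσ : 0 ≤ σ) (hα : 0 ≤ α)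
    (hu : 0 < u) (hnσ : 1 ≤ n * σ ^ 2) (hH : ∀ i, 0 ≤ H i) (j : ℕ) :
    (∑ i ∈ Finset.range (j + 2), H i) + 2 * cOne * n * α + 1 / 2 ^ 25 * (j + 1) ≤
      n * chainDev n σ α u H j ^ 2 / (2 * (u / 2 ^ j) ^ 2) := by
  have hn' : (0 : ℝ) < n := by exact_mod_cast hn
  have hc := cOne_pos
  set A := ∑ i ∈ Finset.range (j + 2), √(H i) with hA
  have hA0 : 0 ≤ A := Finset.sum_nonneg fun _ _ => Real.sqrt_nonneg _
  have hAH := sum_le_sq_sum_sqrt hH (j + 2)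
  have hu' : u / 2 ^ j ≠ 0 := by positivity
  have e1 : n * chainDev n σ α u H j ^ 2 / (2 * (u / 2 ^ j) ^ 2) =
      n / 2 * (√(2 / n) * A + √(4 * cOne * α) + 1 / 2 ^ 12 * (j + 1) * σ) ^ 2 := by
    unfold chainDev
    rw [mul_pow, ← hA]
    field_simp
  rw [e1]
  have s1 : √(2 / (n : ℝ)) ^ 2 = 2 / n := Real.sq_sqrt (by positivity)
  have s2 : √(4 * cOne * α) ^ 2 = 4 * cOne * α := Real.sq_sqrt (by positivity)
  have h1 : (√(2 / n) * A) ^ 2 + √(4 * cOne * α) ^ 2 + (1 / 2 ^ 12 * (j + 1) * σ) ^ 2 ≤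
      (√(2 / n) * A + √(4 * cOne * α) + 1 / 2 ^ 12 * (j + 1) * σ) ^ 2 := by
    have a1 : 0 ≤ √(2 / (n : ℝ)) * A := by positivity
    have a2 : 0 ≤ √(4 * cOne * α) := by positivity
    have a3 : 0 ≤ 1 / 2 ^ 12 * ((j : ℝ) + 1) * σ := by positivity
    nlinarith [mul_nonneg a1 a2, mul_nonneg a1 a3, mul_nonneg a2 a3]
  have h2 := mul_le_mul_of_nonneg_left h1 (by positivity : (0 : ℝ) ≤ n / 2)
  refine le_trans ?_ h2
  rw [mul_pow, s1, s2]
  have e2 : (n : ℝ) / 2 * (2 / n * A ^ 2 + 4 * cOne * α + (1 / 2 ^ 12 * (j + 1) * σ) ^ 2) =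
      A ^ 2 + 2 * cOne * n * α + 1 / 2 ^ 25 * (j + 1) ^ 2 * (n * σ ^ 2) := by
    field_simp; ring
  rw [e2]
  have h3 : (1 : ℝ) / 2 ^ 25 * (j + 1) ≤ 1 / 2 ^ 25 * (j + 1) ^ 2 * (n * σ ^ 2) := by
    have hj : (0 : ℝ) ≤ j := by positivity
    have : ((j : ℝ) + 1) * 1 ≤ (j + 1) ^ 2 * (n * σ ^ 2) := by
      gcongr; nlinarith
    linarith
  linarith

theorem sum_chainDev_eq (n : ℕ) (σ α u : ℝ) (H : ℕ → ℝ) (J : ℕ) :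
    ∑ j ∈ Finset.range J, chainDev n σ α u H j =
      √(2 / n) * (u * ∑ j ∈ Finset.range J, 1 / 2 ^ j * ∑ i ∈ Finset.range (j + 2), √(H i)) +
      u * √(4 * cOne * α) * (∑ j ∈ Finset.range J, 1 / 2 ^ j) +
      1 / 2 ^ 12 * u * σ * ∑ j ∈ Finset.range J, 1 / 2 ^ j * ((j : ℝ) + 1) := by
  simp only [Finset.mul_sum, ← Finset.sum_add_distrib]
  refine Finset.sum_congr rfl fun j _ => ?_
  rw [chainDev, ← Finset.mul_sum, ← Finset.mul_sum, ← Finset.mul_sum]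
  ring

/-- The total deviation over the chain and at its base is a small multiple of `κ α`. -/
theorem total_dev_le {n : ℕ} {σ α u κ : ℝ} {H : ℕ → ℝ} {J : ℕ} (hn : 0 < n) (hσ : 0 < σ)
    (hκ : 1 ≤ κ) (hσα : σ ^ 2 ≤ 32 * κ * α) (hu : σ / 16 ≤ u) (hJ : J = 0 ∨ u ≤ σ / 8)
    (hH : ∀ i, 0 ≤ H i)
    (hsum : ∑ j ∈ Finset.range (J + 1), u / 2 ^ j * √(H j) ≤ 2 * (1 / 2 ^ 27 * √n * σ ^ 2)) :
    2 ^ 9 * (2 * cOne * α + H 0 / n) + ∑ j ∈ Finset.range J, chainDev n σ α u H j ≤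
      α * (κ / 64 + 1 / 64) := by
  have hn' : (0 : ℝ) < n := by exact_mod_cast hn
  have hsn : 0 < √(n : ℝ) := Real.sqrt_pos.2 hn'
  have hu0 : 0 < u := by linarith
  have hα : 0 < α := by
    by_contra h
    have : κ * α ≤ 0 := mul_nonpos_of_nonneg_of_nonpos (by linarith) (not_lt.1 h)
    nlinarith [sq_pos_of_pos hσ]
  have hκα : α ≤ κ * α := le_mul_of_one_le_left hα.le hκ
  -- This is where the value of c₁ is nearly used up: 2¹⁰c₁ = 63/4112, just below 1/64.
  have b1 : 2 ^ 9 * (2 * cOne * α) ≤ α * (1 / 64) := by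
    unfold cOne; linarith
  have b2 : 2 ^ 9 * (H 0 / n) ≤ κ * α / 2 ^ 30 := by
    have h1 : u * √(H 0) ≤ 2 * (1 / 2 ^ 27 * √n * σ ^ 2) := by
      refine le_trans ?_ hsum
      have := Finset.single_le_sum (f := fun j => u / 2 ^ j * √(H j))
        (fun _ _ => by positivity) (Finset.mem_range.2 (Nat.succ_pos J))
      simpa using this
    have h2 : √(H 0) ≤ √n * σ / 2 ^ 22 := by
      have h3 : σ / 16 * √(H 0) ≤ σ / 16 * (√n * σ / 2 ^ 22) := by
        calc _ ≤ u * √(H 0) := by gcongr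
          _ ≤ _ := h1
          _ = _ := by ring
      exact le_of_mul_le_mul_left h3 (by positivity)
    have h4 : H 0 ≤ n * σ ^ 2 / 2 ^ 44 := by
      have h5 := pow_le_pow_left₀ (Real.sqrt_nonneg _) h2 2
      rw [Real.sq_sqrt (hH 0), div_pow, mul_pow, Real.sq_sqrt hn'.le] at h5
      norm_num at h5 ⊢
      exact h5
    have h6 : H 0 / n ≤ σ ^ 2 / 2 ^ 44 := by
      rw [div_le_iff₀ hn']; linarith
    linarith
  have b3 : ∑ j ∈ Finset.range J, chainDev n σ α u H j ≤ κ * α * (1 / 64 - 1 / 2 ^ 30) := by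
    -- With a single level there are no links to pay for; otherwise u ≤ σ/8 is available.
    rcases hJ with rfl | hu8
    · simp only [Finset.range_zero, Finset.sum_empty]
      have : 0 < κ * α := by linarith
      positivity
    rw [sum_chainDev_eq]
    have t1 : √(2 / n) * (u * ∑ j ∈ Finset.range J, 1 / 2 ^ j * ∑ i ∈ Finset.range (j + 2), √(H i))
        ≤ 1 / 2 ^ 23 * σ ^ 2 := by
      have h1 := sum_dyadic_partial_sums_le (a := fun i => √(H i)) (fun _ => Real.sqrt_nonneg _) J
      have h2 : u * (4 * ∑ i ∈ Finset.range (J + 1), 1 / 2 ^ i * √(H i)) ≤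
          4 * (2 * (1 / 2 ^ 27 * √n * σ ^ 2)) := by
        calc _ = 4 * ∑ j ∈ Finset.range (J + 1), u / 2 ^ j * √(H j) := by
              rw [mul_left_comm]
              congr 1
              rw [Finset.mul_sum]
              exact Finset.sum_congr rfl fun j _ => by ring
          _ ≤ _ := by gcongr
      calc _ ≤ √(2 / n) * (4 * (2 * (1 / 2 ^ 27 * √n * σ ^ 2))) := by
            exact mul_le_mul_of_nonneg_left ((mul_le_mul_of_nonneg_left h1 hu0.le).trans h2)
              (Real.sqrt_nonneg _)
        _ = √2 * (1 / 2 ^ 24 * σ ^ 2) := by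
            rw [Real.sqrt_div zero_le_two]; field_simp; norm_num
        _ ≤ 2 * (1 / 2 ^ 24 * σ ^ 2) := by
            gcongr
            exact Real.sqrt_le_iff.2 ⟨by norm_num, by norm_num⟩
        _ = _ := by ring
    have t2 : u * √(4 * cOne * α) * (∑ j ∈ Finset.range J, 1 / 2 ^ j) ≤ 11 / 1000 * (κ * α) := by
      have h1 : σ * √(4 * cOne * α) ≤ 44 / 1000 * (κ * α) := by
        refine abs_le_of_sq_le_sq' ?_ (by positivity) |>.2
        have hc := cOne_pos
        rw [mul_pow, Real.sq_sqrt (by positivity)]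
        calc σ ^ 2 * (4 * cOne * α) ≤ 32 * κ * α * (4 * cOne * α) := by gcongr
          _ = 128 * cOne * (α * (κ * α)) := by ring
          _ ≤ 128 * cOne * (κ * α * (κ * α)) := by gcongr
          _ ≤ (44 / 1000) ^ 2 * (κ * α * (κ * α)) := by
              gcongr
              unfold cOne; norm_num
          _ = _ := by ring
      calc _ ≤ σ / 8 * √(4 * cOne * α) * 2 := by
            gcongr
            exact sum_dyadic_le J
        _ = (σ * √(4 * cOne * α)) / 4 := by ring
        _ ≤ _ := by linarith
    have t3 : 1 / 2 ^ 12 * u * σ * ∑ j ∈ Finset.range J, 1 / 2 ^ j * ((j : ℝ) + 1) ≤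
        κ * α / 256 := by
      calc _ ≤ 1 / 2 ^ 12 * (σ / 8) * σ * 4 := by
            gcongr
            exact sum_dyadic_mul_le J
        _ = σ ^ 2 / 2 ^ 13 := by ring
        _ ≤ _ := by linarith
    linarith
  linarith

theorem natCast_mul_ofReal_exp_le {N : ℕ} {a b : ℝ} (hN : 0 < N) (h : Real.log N + b ≤ a) :
    (N : ℝ≥0∞) * ENNReal.ofReal (Real.exp (-a)) ≤ ENNReal.ofReal (Real.exp (-b)) := by
  have hN' : (0 : ℝ) < N := by exact_mod_cast hN
  rw [← ENNReal.ofReal_natCast, ← ENNReal.ofReal_mul hN'.le]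
  refine ENNReal.ofReal_le_ofReal ?_
  calc (N : ℝ) * Real.exp (-a) = Real.exp (Real.log N + -a) := by
        rw [Real.exp_add, Real.exp_log hN']
    _ ≤ _ := Real.exp_le_exp.2 (by linarith)

/-! ### The uniform deviation inequality. -/

section Deviation

variable {X Y Ω : Type*} [MeasurableSpace X] [MeasurableSpace Y] [MeasurableSpace Ω]
  {Q : Measure X} [IsProbabilityMeasure Q] {ν : Measure Y} [SigmaFinite ν] {μ : Measure Ω}
  {P : Set (X → Y → ℝ)} {p₀ : X → Y → ℝ} {n : ℕ} {Z : Fin n → Ω → X × Y}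

/-- Uniformly over the family, the empirical mean of the smoothed log-likelihood ratio exceeds its
expectation by little, up to an exponentially small probability. -/
theorem measure_exists_dev_le (hP : ∀ p ∈ P, IsCondDensity ν p) (hp₀ : p₀ ∈ P) (hn : 0 < n)
    (hZ : ∀ i, Measurable (Z i)) (hind : iIndepFun Z μ) (hmap : ∀ i, μ.map (Z i) = jointLaw Q ν p₀)
    {τ σ α : ℝ} (hτ : 0 < τ) (hσ : 0 < σ) (hσ9 : σ ≤ 2 ^ 9) (hnσ : 1 ≤ n * σ ^ 2)
    (hσα : σ ^ 2 ≤ 32 * kappa τ * α)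
    (hint : (∫⁻ u in Set.Ioc (σ ^ 2 / 2 ^ 10) σ,
      bracketingEntropy Q ν (u / (2 * √2 * Real.exp (τ / 2))) P ^ (1 / 2 : ℝ)) ≤
        ENNReal.ofReal (1 / 2 ^ 27 * √n * σ ^ 2)) :
    μ {ω | ∃ p : P, n * ((∫ z, logMix τ (ratio p₀ p z) ∂jointLaw Q ν p₀) +
        α * (kappa τ / 16 + kappa τ ^ 2 * Real.exp (-τ) / 16 + kappa τ / 64 + 1 / 64) +
        kappa τ / 64 * (1 - ∫ z, √(ratio p₀ p z) ∂jointLaw Q ν p₀)) ≤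
          ∑ i, logMix τ (ratio p₀ p (Z i ω))} ≤
      ENNReal.ofReal ((1 + 2 ^ 25) * Real.exp (-2 * cOne * n * α)) := by
  classical
  have h₀ := hP p₀ hp₀
  have hpr := isProbabilityMeasure_jointLaw (Q := Q) h₀
  have hκ := one_le_kappa hτ
  have hn' : (0 : ℝ) < n := by exact_mod_cast hn
  have hα : 0 < α := by
    by_contra h
    have : kappa τ * α ≤ 0 := mul_nonpos_of_nonneg_of_nonpos (by linarith) (not_lt.1 h)
    nlinarith [sq_pos_of_pos hσ]
  obtain ⟨J, u, B, huJ, huσ, hu16, hJ, hB, hsum⟩ :=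
    exists_levels hσ hσ9 (by positivity : (0:ℝ) ≤ 1 / 2 ^ 27 * √n * σ ^ 2) hint
  have hu : 0 < u := by linarith
  set s : ℝ := 2 * √2 * Real.exp (τ / 2) with hs
  have hs0 : 0 < s := by positivity
  have hex : ∀ (p : P) (j : ℕ), j ≤ J → ∃ c ∈ B j,
      IsUpperBracket (jointLaw Q ν p₀) (u / 2 ^ j / s) (ratio p₀ p) (ratio p₀ c) := by
    intro p j hj
    obtain ⟨b, hb, c, hc, hH, hbc⟩ := (hB j hj).cover p p.2
    exact ⟨c, hc, isUpperBracket_ratio h₀ ((hB j hj).measurable b hb) ((hB j hj).measurable c hc)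
      ((hB j hj).nonneg b hb) (fun x y => (hbc x y).1) (fun x y => (hbc x y).2) (by positivity) hH⟩
  choose! c hcB hc using hex
  set F : ℕ → Finset (X × Y → ℝ) := fun j => (B j).image fun b z => logMix τ (ratio p₀ b z) with hF
  -- Covers are nonempty because p₀ belongs to the family, so the logarithms of the cardinalities
  -- carry their usual meaning.
  have hFpos : ∀ j ≤ J, 0 < (F j).card := fun j hj =>
    Finset.card_pos.2 ⟨_, Finset.mem_image_of_mem _ (hcB ⟨p₀, hp₀⟩ j hj)⟩
  set H : ℕ → ℝ := fun j => Real.log (F j).card with hHdef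
  have hH0 : ∀ j, 0 ≤ H j := fun j => Real.log_natCast_nonneg _
  have hsumH : ∑ j ∈ Finset.range (J + 1), u / 2 ^ j * √(H j) ≤
      2 * (1 / 2 ^ 27 * √n * σ ^ 2) := by
    refine (Finset.sum_le_sum fun j hj => ?_).trans hsum
    have hj' := hFpos j (Nat.lt_succ_iff.1 (Finset.mem_range.1 hj))
    have hle : (F j).card ≤ (B j).card := Finset.card_image_le
    have : H j ≤ Real.log (B j).card :=
      Real.log_le_log (by exact_mod_cast hj') (by exact_mod_cast hle)
    gcongr
  set t : ℝ := 1 / 2 ^ 9 with ht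
  -- Chosen so that n t x₀ = 2c₁nα + `H 0`: the Chernoff exponent absorbs the size of the coarsest
  -- cover.
  set x₀ : ℝ := 2 ^ 9 * (2 * cOne * α + H 0 / n) with hx₀
  have hρm : ∀ p : P, Measurable (ratio p₀ p) := fun p => measurable_ratio h₀ (hP p p.2).measurable
  have hρ0 : ∀ (p : P) z, 0 ≤ ratio p₀ p z := fun p => ratio_nonneg h₀ (hP p p.2).nonneg
  have hρi := fun p : P => integrable_ratio (Q := Q) h₀ (hP p p.2)
  have hgi : ∀ p : P, Integrable (fun z => logMix τ (ratio p₀ p z)) (jointLaw Q ν p₀) :=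
    fun p => integrable_logMix hτ (hρm p) (hρ0 p) (hρi p).1
  have hε : ∀ j, 2 * √2 * Real.exp (τ / 2) * (u / 2 ^ j / s) = u / 2 ^ j := fun j => by
    rw [← hs]; field_simp
  have hexp := fun p : P => (hc p 0 (Nat.zero_le _)).integral_exp_le hτ (hρm p) (hρ0 p) (hρi p).1
    (hρi p).2 (t := t) (by norm_num [ht]) (by norm_num [ht])
  have hchain := measure_chain_le hZ hind hmap (ι := P) (J := J)
    (g := fun p z => logMix τ (ratio p₀ p z)) (r := fun p j z => logMix τ (ratio p₀ (c p j) z))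
    (F := F) (u := fun j => u / 2 ^ j)
    (fun p j hj => Finset.mem_image_of_mem _ (hcB p j hj)) hgi
    (fun p j hj => measurable_logMix (hc p j hj).measurable)
    (fun p j hj => integrable_logMix hτ (hc p j hj).measurable ((hc p j hj).nonneg (hρ0 p))
      ((hc p j hj).integrable (hρm p) (hρ0 p) (hρi p).1))
    (fun p j hj z => logMix_mono hτ (hρ0 p z) ((hc p j hj).le z))
    (fun p j hj => ((hc p j hj).sq_logMix_sub hτ (hρm p) (hρ0 p)).1)
    (fun j _ => by positivity)
    (fun p j hj => by
      have := ((hc p j hj).sq_logMix_sub hτ (hρm p) (hρ0 p)).2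
      rwa [hε] at this)
    (t := t) (by norm_num [ht])
    (b := fun f => 2 * t * kappa τ * ∫ z, (1 - Real.exp (f z / 2)) ^ 2 ∂jointLaw Q ν p₀)
    (fun p => (hexp p).1) (fun p => (hexp p).2) x₀ (x := chainDev n σ α u H)
    (fun j _ => chainDev_nonneg hσ.le hu.le j)
  have htotal := total_dev_le hn hσ hκ hσα hu16 hJ hH0 hsumH
  refine (measure_mono ?_).trans (hchain.trans ?_)
  · rintro ω ⟨p, hp⟩
    refine ⟨p, le_trans (mul_le_mul_of_nonneg_left ?_ hn'.le) hp⟩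
    have hb := ((hc p 0 (Nat.zero_le _)).sq_sub_exp_half hτ (hρm p) (hρ0 p) (hρi p).1 (hρi p).2).2
    have hb' := mul_le_mul_of_nonneg_left hb (by positivity : 0 ≤ 2 * t * kappa τ)
    -- From u² ≤ σ² ≤ 32κα and s² = 8e^τ. Multiplied by 8tκ = κ/64, it gives the term κ²e^{-τ}/16 of
    -- the deviation constant.
    have hε0 : (u / 2 ^ 0 / s) ^ 2 ≤ 4 * kappa τ * α * Real.exp (-τ) := by
      have hs2 : s ^ 2 = 8 * Real.exp τ := by
        rw [hs, mul_pow, mul_pow, Real.sq_sqrt zero_le_two, ← Real.exp_nat_mul]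
        norm_num
        rw [mul_div_cancel₀ _ two_ne_zero]
      rw [pow_zero, div_one, div_pow, hs2, Real.exp_neg, div_le_iff₀ (by positivity)]
      have : u ^ 2 ≤ σ ^ 2 := by gcongr
      have he := Real.exp_pos τ
      field_simp
      linarith
    have hb2 : 2 * t * kappa τ * (4 * (u / 2 ^ 0 / s) ^ 2) ≤
        α * (kappa τ ^ 2 * Real.exp (-τ) / 16) := by
      calc _ ≤ 2 * t * kappa τ * (4 * (4 * kappa τ * α * Real.exp (-τ))) := by gcongr
        _ = _ := by rw [ht]; ring
    have hbias : u / 2 ^ J ≤ α * (kappa τ / 16) := by rw [huJ]; linarith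
    have ht' : 2 * t * kappa τ * 4 = kappa τ / 64 := by rw [ht]; ring
    have hb3 : 2 * t * kappa τ * (4 * ((u / 2 ^ 0 / s) ^ 2 +
        (1 - ∫ z, √(ratio p₀ p z) ∂jointLaw Q ν p₀))) =
        2 * t * kappa τ * (4 * (u / 2 ^ 0 / s) ^ 2) +
          kappa τ / 64 * (1 - ∫ z, √(ratio p₀ p z) ∂jointLaw Q ν p₀) := by
      rw [← ht']; ring
    rw [hb3] at hb'
    simp only
    linarith
  · have hq0 : ((F 0).card : ℝ≥0∞) * ENNReal.ofReal (Real.exp (-(n * (t * x₀)))) ≤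
        ENNReal.ofReal (Real.exp (-(2 * cOne * n * α))) := by
      refine natCast_mul_ofReal_exp_le (hFpos 0 (Nat.zero_le _)) (le_of_eq ?_)
      rw [ht, hx₀]
      field_simp
      ring
    have hqj : ∀ j ∈ Finset.range J, ((∏ i ∈ Finset.range (j + 2), (F i).card : ℕ) : ℝ≥0∞) *
        ENNReal.ofReal (Real.exp (-(n * chainDev n σ α u H j ^ 2 / (2 * (u / 2 ^ j) ^ 2)))) ≤
        ENNReal.ofReal (Real.exp (-(2 * cOne * n * α)) *
          Real.exp (-(1 / 2 ^ 25 * ((j : ℝ) + 1)))) := by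
      intro j hj
      have hj' := Finset.mem_range.1 hj
      rw [← Real.exp_add, ← neg_add]
      have hne : ∀ i ∈ Finset.range (j + 2), 0 < (F i).card := fun i hi =>
        hFpos i (by have := Finset.mem_range.1 hi; omega)
      refine natCast_mul_ofReal_exp_le (Finset.prod_pos hne) ?_
      rw [Nat.cast_prod, Real.log_prod fun i hi => by exact_mod_cast (hne i hi).ne']
      have := le_mul_sq_chainDev hn hσ.le hα.le hu hnσ hH0 j
      linarith
    -- The base contributes 1 and the geometric series over the links at most 2²⁵, whence the
    -- universal constant.
    have hfinal : Real.exp (-(2 * cOne * n * α)) + ∑ j ∈ Finset.range J,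
        Real.exp (-(2 * cOne * n * α)) * Real.exp (-(1 / 2 ^ 25 * ((j : ℝ) + 1))) ≤
        (1 + 2 ^ 25) * Real.exp (-2 * cOne * n * α) := by
      have := sum_exp_neg_le (δ := 1 / 2 ^ 25) (by positivity) J
      rw [one_div_one_div] at this
      rw [← Finset.mul_sum, show -2 * cOne * n * α = -(2 * cOne * n * α) by ring]
      nlinarith [Real.exp_pos (-(2 * cOne * n * α))]
    refine le_trans (add_le_add hq0 (Finset.sum_le_sum hqj)) ?_
    rw [← ENNReal.ofReal_sum_of_nonneg fun j _ => by positivity,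
      ← ENNReal.ofReal_add (by positivity) (Finset.sum_nonneg fun j _ => by positivity)]
    exact ENNReal.ofReal_le_ofReal hfinal

end Deviation

/-! ### From log-likelihood ratios to the uncertainty set. -/

section Likelihood

variable {X Y : Type*} {n : ℕ} {D : Fin n → X × Y} {p : X → Y → ℝ}

theorem negLogLik_of_pos (h : ∀ i, 0 < p (D i).1 (D i).2) :
    negLogLik D p = ((-(1 / n * ∑ i, Real.log (p (D i).1 (D i).2)) : ℝ) : EReal) := by
  have h1 : ∀ i, -ENNReal.log (ENNReal.ofReal (p (D i).1 (D i).2)) =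
      ((-Real.log (p (D i).1 (D i).2) : ℝ) : EReal) := fun i => by
    rw [ENNReal.log_ofReal_of_pos (h i), EReal.coe_neg]
  unfold negLogLik
  simp_rw [h1]
  have h2 := map_sum (⟨⟨Real.toEReal, EReal.coe_zero⟩, EReal.coe_add⟩ : ℝ →+ EReal)
    (fun i => -Real.log (p (D i).1 (D i).2)) Finset.univ
  simp only [AddMonoidHom.coe_mk, ZeroHom.coe_mk] at h2
  rw [← h2, ← EReal.coe_mul, Finset.sum_neg_distrib, mul_neg]

theorem negLogLik_eq_top (hn : 0 < n) {i : Fin n} (h : p (D i).1 (D i).2 ≤ 0) :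
    negLogLik D p = ⊤ := by
  -- In `EReal` the sum ⊤ + ⊥ is ⊥, so one infinite summand forces ⊤ only when no summand is ⊥.
  have hbot : ∀ s : Finset (Fin n),
      ∑ j ∈ s, -ENNReal.log (ENNReal.ofReal (p (D j).1 (D j).2)) ≠ ⊥ := by
    intro s
    induction s using Finset.cons_induction with
    | empty => simp
    | cons j s hj ih =>
      rw [Finset.sum_cons]
      refine EReal.add_ne_bot_iff.2 ⟨?_, ih⟩
      rw [Ne, EReal.neg_eq_bot_iff, ENNReal.log_eq_top_iff]
      exact ENNReal.ofReal_ne_top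
  have hi : -ENNReal.log (ENNReal.ofReal (p (D i).1 (D i).2)) = ⊤ := by
    rw [ENNReal.ofReal_of_nonpos h]; simp
  unfold negLogLik
  rw [← Finset.add_sum_erase _ _ (Finset.mem_univ i), hi, EReal.top_add_of_ne_bot (hbot _),
    EReal.coe_mul_top_of_pos (by positivity)]

theorem pos_of_negLogLik_ne_top (hn : 0 < n) (h : negLogLik D p ≠ ⊤) (i : Fin n) :
    0 < p (D i).1 (D i).2 := by
  by_contra hi
  exact h (negLogLik_eq_top hn (not_lt.1 hi))

theorem sum_log_ratio {p₀ : X → Y → ℝ} (h₀ : ∀ i, 0 < p₀ (D i).1 (D i).2)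
    (h : ∀ i, 0 < p (D i).1 (D i).2) :
    ∑ i, Real.log (ratio p₀ p (D i)) =
      (∑ i, Real.log (p (D i).1 (D i).2)) - ∑ i, Real.log (p₀ (D i).1 (D i).2) := by
  rw [← Finset.sum_sub_distrib]
  exact Finset.sum_congr rfl fun i _ => Real.log_div (h i).ne' (h₀ i).ne'

variable [MeasurableSpace X] [MeasurableSpace Y] {Q : Measure X} {ν : Measure Y}
  {P : Set (X → Y → ℝ)} {p₀ pHat : X → Y → ℝ}

/-- The two assertions on the uncertainty set, from bounds on the log-likelihood ratios. -/
theorem uncertaintySet_of_sum_log_le (hn : 0 < n) (hp₀ : p₀ ∈ P)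
    (hpos : ∀ i, 0 < p₀ (D i).1 (D i).2) (hMLE : IsMLE P D pHat) {α : ℝ} {β : ℝ≥0∞}
    (h1 : ∀ p ∈ P, (∀ i, 0 < p (D i).1 (D i).2) → ∑ i, Real.log (ratio p₀ p (D i)) ≤ n * α)
    (h2 : ∀ p ∈ P, (∀ i, 0 < p (D i).1 (D i).2) →
      -(n * α) ≤ ∑ i, Real.log (ratio p₀ p (D i)) → hellingerSq Q ν p p₀ ≤ β) :
    p₀ ∈ uncertaintySet P D pHat α ∧
      (⨆ p ∈ uncertaintySet P D pHat α, hellingerSq Q ν p p₀) ≤ β := by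
  have hn' : (0 : ℝ) < n := by exact_mod_cast hn
  have hle := hMLE.2 p₀ hp₀
  have hL₀ := negLogLik_of_pos hpos
  -- The estimator does at least as well as p₀, whose loss is finite, so it vanishes at no data
  -- point.
  have hHat : ∀ i, 0 < pHat (D i).1 (D i).2 := by
    refine pos_of_negLogLik_ne_top hn fun htop => ?_
    rw [htop, hL₀, top_le_iff] at hle
    exact EReal.coe_ne_top _ hle
  have hLHat := negLogLik_of_pos hHat
  rw [hL₀, hLHat, EReal.coe_le_coe_iff] at hle
  refine ⟨⟨hp₀, ?_⟩, iSup₂_le fun p ⟨hp, hpα⟩ => ?_⟩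
  · rw [hL₀, hLHat, ← EReal.coe_sub, EReal.coe_le_coe_iff]
    have h3 := h1 pHat hMLE.1 hHat
    rw [sum_log_ratio hpos hHat] at h3
    have h4 := mul_le_mul_of_nonneg_left h3 (by positivity : (0 : ℝ) ≤ 1 / n)
    rw [← mul_assoc, one_div_mul_cancel hn'.ne'] at h4
    linarith
  · have hppos : ∀ i, 0 < p (D i).1 (D i).2 := by
      refine pos_of_negLogLik_ne_top hn fun htop => ?_
      rw [htop, hLHat, EReal.top_sub_coe, top_le_iff] at hpα
      exact EReal.coe_ne_top _ hpα
    refine h2 p hp hppos ?_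
    rw [negLogLik_of_pos hppos, hLHat, ← EReal.coe_sub, EReal.coe_le_coe_iff] at hpα
    rw [sum_log_ratio hpos hppos]
    have h5 : -α ≤ 1 / n * ((∑ i, Real.log (p (D i).1 (D i).2)) -
        ∑ i, Real.log (p₀ (D i).1 (D i).2)) := by linarith
    have h6 := mul_le_mul_of_nonneg_left h5 hn'.le
    rw [← mul_assoc, mul_one_div_cancel hn'.ne'] at h6
    linarith

end Likelihood

/-! ### Numerical bounds on the deviation constant, and the theorem. -/

/-- The deviation constant is at most `1 - e^{-τ}`. -/
theorem dev_const_le {τ : ℝ} (hτ : 0 < τ) (h : kappa τ < 8 * (1 - Real.exp (-τ)) ^ 2) :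
    kappa τ / 16 + kappa τ ^ 2 * Real.exp (-τ) / 16 + kappa τ / 64 + 1 / 64 ≤
      1 - Real.exp (-τ) := by
  obtain ⟨he0, he1⟩ := exp_neg_mem hτ
  have hκ := one_le_kappa hτ
  obtain ⟨x, hx⟩ : ∃ x, x = 1 - Real.exp (-τ) := ⟨_, rfl⟩
  have he : Real.exp (-τ) = 1 - x := by rw [hx]; ring
  rw [← hx] at h
  rw [he] at he0 he1 ⊢
  have hx0 : 0 < x := by linarith
  have hx2 : 1 / 3 ≤ x := by nlinarith
  have h2 : kappa τ ^ 2 ≤ (8 * x ^ 2) ^ 2 := by gcongr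
  have h3 : kappa τ ^ 2 * (1 - x) ≤ (8 * x ^ 2) ^ 2 * (1 - x) := by gcongr
  -- Insert κ ≤ 8x² in each term and 1/64 ≤ x/20, valid since x ≥ 1/3; what remains to check is
  -- 5x²/8 + 4x⁴(1 - x) + x/20 ≤ x.
  have h4 : 0 ≤ x * (19 / 20 - 5 / 8 * x - 4 * x ^ 3 * (1 - x)) := by
    refine mul_nonneg hx0.le ?_
    nlinarith [sq_nonneg (x ^ 2 - x / 2 - 1 / 4), sq_nonneg (x - 4 / 5), sq_nonneg (x ^ 2 - 16 / 25)]
  nlinarith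

/-- Uses κe^{-τ} ≤ 32/27 and 1 ≤ κ: the coefficient 1/16 + 2/27 + 1/32 is below 3/16. -/
theorem dev_const_lt {τ : ℝ} (hτ : 0 < τ) (h : kappa τ < 8 * (1 - Real.exp (-τ)) ^ 2) :
    kappa τ / 16 + kappa τ ^ 2 * Real.exp (-τ) / 16 + kappa τ / 64 + 1 / 64 ≤
      3 / 16 * kappa τ := by
  have hκ := one_le_kappa hτ
  have h1 := mul_le_mul_of_nonneg_left (kappa_mul_exp_neg_le hτ h) (by linarith : 0 ≤ kappa τ)
  nlinarith

end CondMLE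

open CondMLE
theorem mainTheorem1 :
    -- the admissible range of the smoothing parameter
    (∃ a b : ℝ, a ∈ Set.Ioo (0.5517 : ℝ) 0.5518 ∧ b ∈ Set.Ioo (3.1926 : ℝ) 3.1927 ∧
      ∀ τ : ℝ, 0 < τ → (kappa τ < 8 * (1 - Real.exp (-τ)) ^ 2 ↔ a < τ ∧ τ < b)) ∧
    -- positivity of `c(τ)` and its maximum
    (∀ τ : ℝ, 0 < τ → kappa τ < 8 * (1 - Real.exp (-τ)) ^ 2 → 0 < cTau τ) ∧
    (∃ τ : ℝ, |τ - 1.7024| < 0.00005 ∧ |cTau τ - 0.1802| < 0.00005 ∧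
      0 < τ ∧ kappa τ < 8 * (1 - Real.exp (-τ)) ^ 2 ∧ IsMaxOn cTau (Set.Ioi 0) τ) ∧
    -- the concentration result, with a universal constant `c`
    ∃ c : ℝ, 0 < c ∧
      ∀ (τ : ℝ), 0 < τ → kappa τ < 8 * (1 - Real.exp (-τ)) ^ 2 →
      ∀ (X : Type*) [MeasurableSpace X] (Y : Type*) [MeasurableSpace Y]
        (Q : Measure X) [IsProbabilityMeasure Q] (ν : Measure Y) [SigmaFinite ν]
        (P : Set (X → Y → ℝ)) (p₀ : X → Y → ℝ),
        (∀ p ∈ P, IsCondDensity ν p) → p₀ ∈ P →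
      ∀ (n : ℕ), 0 < n →
      -- i.i.d. data on a probability space
      ∀ (Ω : Type*) [MeasurableSpace Ω] (μ : Measure Ω) [IsProbabilityMeasure μ]
        (Z : Fin n → Ω → X × Y),
        (∀ i, Measurable (Z i)) → iIndepFun Z μ → (∀ i, μ.map (Z i) = jointLaw Q ν p₀) →
      -- the maximum likelihood estimator
      ∀ (pHat : Ω → X → Y → ℝ), (∀ᵐ ω ∂μ, IsMLE P (fun i => Z i ω) (pHat ω)) →
      ∀ (σn αn : ℝ), 0 < σn → 0 < αn → αn = σn ^ 2 / (8 * kappa τ) →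
        1 / (n : ℝ) ≤ σn ^ 2 → σn ≤ 2 ^ 9 →
        (∫⁻ u in Set.Ioc (σn ^ 2 / 2 ^ 10) σn,
            bracketingEntropy Q ν (u / (2 * √2 * Real.exp (τ / 2))) P ^ (1 / 2 : ℝ))
          ≤ ENNReal.ofReal (1 / 2 ^ 27 * √n * σn ^ 2) →
      ∀ α : ℝ, αn / 4 ≤ α →
        -- the (outer) probability that (i) or (ii) fails is at most `c * exp (-2 c₁ n α)`
        μ {ω | ¬ (p₀ ∈ uncertaintySet P (fun i => Z i ω) (pHat ω) α ∧
            (⨆ p ∈ uncertaintySet P (fun i => Z i ω) (pHat ω) α, hellingerSq Q ν p p₀)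
              ≤ ENNReal.ofReal (α / cTau τ))}
          ≤ ENNReal.ofReal (c * Real.exp (-2 * cOne * n * α)) := by
  refine ⟨exists_admissible_interval, fun τ => cTau_pos, exists_isMaxOn_cTau, 1 + 2 ^ 25,
    by positivity, ?_⟩
  intro τ hτ hadm X _ Y _ Q _ ν _ P p₀ hP hp₀ n hn Ω _ μ _ Z hZ hind hmap pHat hMLE σ αn hσ hαn
    hαn_eq hnσ hσ9 hint α hα
  have h₀ := hP p₀ hp₀
  have hn' : (0 : ℝ) < n := by exact_mod_cast hn
  have hκ := one_le_kappa hτ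
  have hα0 : 0 < α := by linarith
  have hσα : σ ^ 2 ≤ 32 * kappa τ * α := by
    have : σ ^ 2 = 8 * kappa τ * αn := by rw [hαn_eq]; field_simp
    rw [this]; nlinarith
  have hnσ' : 1 ≤ n * σ ^ 2 := by
    rwa [div_le_iff₀ hn', mul_comm] at hnσ
  have hpos : ∀ᵐ ω ∂μ, ∀ i, 0 < p₀ (Z i ω).1 (Z i ω).2 := by
    rw [ae_all_iff]
    intro i
    have h := ae_jointLaw_pos (Q := Q) h₀
    rw [← hmap i] at h
    exact ae_of_ae_map (hZ i).aemeasurable h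
  have hbad := measure_exists_dev_le hP hp₀ hn hZ hind hmap hτ hσ hσ9 hnσ' hσα hint
  refine le_trans (measure_mono_ae ?_) hbad
  filter_upwards [hMLE, hpos] with ω hω hωpos hfail
  by_contra hgood
  refine hfail (uncertaintySet_of_sum_log_le hn hp₀ hωpos hω ?_ ?_)
  all_goals
    intro p hp hppos
    have hdev : ∑ i, logMix τ (ratio p₀ p (Z i ω)) < _ :=
      not_le.1 fun h => hgood ⟨⟨p, hp⟩, h⟩
    obtain ⟨hρi, hρ1⟩ := integrable_ratio (Q := Q) h₀ (hP p hp)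
    have := isProbabilityMeasure_jointLaw (Q := Q) h₀
    have hmean := integral_logMix_le hτ (measurable_ratio h₀ (hP p hp).measurable)
      (ratio_nonneg h₀ (hP p hp).nonneg) hρi hρ1
    obtain ⟨hH, hH0⟩ := hellingerSq_eq (Q := Q) h₀ (hP p hp)
    have hlog : (1 - Real.exp (-τ)) * ∑ i, Real.log (ratio p₀ p (Z i ω)) ≤
        ∑ i, logMix τ (ratio p₀ p (Z i ω)) := by
      rw [Finset.mul_sum]
      exact Finset.sum_le_sum fun i _ => mul_log_le_logMix hτ (div_pos (hppos i) (hωpos i))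
    have hc1 := dev_const_le hτ hadm
    have hc2 := dev_const_lt hτ hadm
    have hc3 := cTau_le_quarter hτ
    have hc4 := cTau_pos hτ hadm
    obtain ⟨he0, he1⟩ := exp_neg_mem hτ
    simp only at hdev
    set lam := 1 - Real.exp (-τ) with hlam
    have hlam0 : 0 < lam := by linarith
    set K := kappa τ / 16 + kappa τ ^ 2 * Real.exp (-τ) / 16 + kappa τ / 64 + 1 / 64
    set h2 := 1 - ∫ z, √(ratio p₀ p z) ∂jointLaw Q ν p₀
    set E := ∫ z, logMix τ (ratio p₀ p z) ∂jointLaw Q ν p₀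
    set S := ∑ i, Real.log (ratio p₀ p (Z i ω))
  -- The negative mean absorbs the variance term, because κ/64 < λ²/8.
  · have h3 : E + α * K + kappa τ / 64 * h2 ≤ lam * α := by
      have : kappa τ / 64 * h2 ≤ lam ^ 2 / 2 * h2 :=
        mul_le_mul_of_nonneg_right (by linarith [sq_nonneg lam]) hH0
      have : α * K ≤ α * lam := by gcongr
      linarith
    have h4 : n * (E + α * K + kappa τ / 64 * h2) ≤ n * (lam * α) := by gcongr
    have h5 : lam * S ≤ lam * (n * α) := by linarith
    exact le_of_mul_le_mul_left h5 hlam0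
  · intro hS
    rw [hH]
    refine ENNReal.ofReal_le_ofReal ?_
    rw [le_div_iff₀ hc4]
    by_contra hcon
    have hcon := not_le.1 hcon
    have hcT : lam * cTau τ = lam ^ 2 / 2 - kappa τ / 16 := by
      rw [cTau, ← hlam]; field_simp; ring
    -- Here α < c(τ)h² ≤ h²/4. The resulting 3κh²/64 and the variance term κh²/64 add up to κh²/16,
    -- exactly what λc(τ) = λ²/2 - κ/16 allows.
    have h3 : α * K ≤ kappa τ / 16 * (3 / 4) * h2 := by
      calc α * K ≤ α * (3 / 16 * kappa τ) := by gcongr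
        _ ≤ (h2 * (1 / 4)) * (3 / 16 * kappa τ) := by
            gcongr
            exact hcon.le.trans (by gcongr)
        _ = _ := by ring
    have h4 : lam * α ≤ lam ^ 2 / 2 * h2 - kappa τ / 16 * h2 := by
      have := mul_le_mul_of_nonneg_left hcon.le hlam0.le
      nlinarith
    have h5 : E + α * K + kappa τ / 64 * h2 ≤ -(lam * α) := by linarith
    have h6 : n * (E + α * K + kappa τ / 64 * h2) ≤ n * (-(lam * α)) := by gcongr
    have h7 := mul_le_mul_of_nonneg_left hS hlam0.le
    linarith
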